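/- A metric Lie algebra $(\mathfrak{s},Q)$ is a finite-dimensional real Lie algebra $\mathfrak{s}$ with an inner product $Q$. Its Ricci operator $\mathrm{Ric}$ is the Ricci operator of the corresponding left-invariant Riemannian metric: $Q(\mathrm{Ric}\,X,Y)=\mathrm{trace}\,(Z\mapsto R(Z,X)Y)$, where $R(X,Y)=\nabla_X\nabla_Y-\nabla_Y\nabla_X-\nabla_{[X,Y]}$ and $2Q(\nabla_XY,Z)=Q([X,Y],Z)-Q([Y,Z],X)+Q([Z,X],Y)$ for all $X,Y,Z\in\mathfrak{s}$. Eigenvalues are counted with multiplicity. A linear operator is called normal (with respect to $Q$) if it commutes with its $Q$-adjoint. Theorem. Let $(\mathfrak{s},Q)$ be a solvable metric Lie algebra, let $\mathfrak{n}=[\mathfrak{s},\mathfrak{s}]$, and let $\mathfrak{a}$ be the $Q$-orthogonal complement of $\mathfrak{n}$ in $\mathfrak{s}$. Then exactly one of the following assertions holds: (1) The ideal $\mathfrak{n}$ is commutative, $\mathfrak{a}$ is a commutative subalgebra of $\mathfrak{s}$, and for every $X\in\mathfrak{a}$ the operator $\mathrm{ad}(X)|_{\mathfrak{n}}$ is skew-symmetric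 with respect to $Q$. (2) The ideal $\mathfrak{n}$ is commutative, $\mathfrak{a}$ is a commutative subalgebra of $\mathfrak{s}$, for every $X\in\mathfrak{a}$ the operator $\mathrm{ad}(X)|_{\mathfrak{n}}$ is trace-free and normal with respect to $Q$, and the subspace $\mathfrak{b}=\{X\in\mathfrak{a} : \mathrm{ad}(X)|_{\mathfrak{n}}\text{ is skew-symmetric with respect to }Q\}$ has codimension $1$ in $\mathfrak{a}$. (3) The Ricci operator of $(\mathfrak{s},Q)$ has at least two negative eigenvalues. Moreover, in case (1) the Ricci operator of $(\mathfrak{s},Q)$ is zero, and in case (2) it has exactly one negative eigenvalue, while all its other eigenvalues are zero. -/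

import Mathlib

namespace MetricLie

section

variable {s : Type*} [LieRing s] [LieAlgebra ℝ s]

/-- `Q` is an inner product: a symmetric, positive definite bilinear form. -/
structure IsInnerProduct {V : Type*} [AddCommGroup V] [Module ℝ V]
    (Q : LinearMap.BilinForm ℝ V) : Prop where
  symm : ∀ x y, Q x y = Q y x
  pos : ∀ x, x ≠ 0 → 0 < Q x x

theorem IsInnerProduct.nondegenerate {V : Type*} [AddCommGroup V] [Module ℝ V]
    {Q : LinearMap.BilinForm ℝ V} (hQ : IsInnerProduct Q) : Q.Nondegenerate := by
  constructor
  · intro x hx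
    by_contra h
    exact (hQ.pos x h).ne' (hx x)
  · intro x hx
    by_contra h
    exact (hQ.pos x h).ne' (hx x)

/-- The derived algebra `[s, s]`, an ideal of `s`. -/
abbrev derived (s : Type*) [LieRing s] [LieAlgebra ℝ s] : LieIdeal ℝ s :=
  ⁅(⊤ : LieIdeal ℝ s), (⊤ : LieIdeal ℝ s)⁆

/-- The `Q`-orthogonal complement of `[s, s]`. -/
def complement (Q : LinearMap.BilinForm ℝ s) : Submodule ℝ s :=
  Q.orthogonal (derived s).toSubmodule

/-- The restriction of `Q` to `[s, s]`. -/
def restrictDerived (Q : LinearMap.BilinForm ℝ s) : LinearMap.BilinForm ℝ (derived s) :=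
  Q.restrict (derived s).toSubmodule

/-- `X ↦ ad(X)|_[s,s]`, as a linear map into the endomorphisms of `[s, s]`. -/
def adDerived (s : Type*) [LieRing s] [LieAlgebra ℝ s] :
    s →ₗ[ℝ] Module.End ℝ (derived s) :=
  (LieModule.toEnd ℝ s (derived s) : s →ₗ[ℝ] Module.End ℝ (derived s))

/-- `A` is skew-symmetric with respect to `B`. -/
def IsSkew {V : Type*} [AddCommGroup V] [Module ℝ V]
    (B : LinearMap.BilinForm ℝ V) (A : Module.End ℝ V) : Prop :=
  ∀ x y, B (A x) y = -B x (A y)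

/-- `A` is normal with respect to `B`: it commutes with its adjoint. -/
def IsNormal {V : Type*} [AddCommGroup V] [Module ℝ V]
    (B : LinearMap.BilinForm ℝ V) (A : Module.End ℝ V) : Prop :=
  ∃ A' : Module.End ℝ V, (∀ x y, B (A x) y = B x (A' y)) ∧ Commute A A'

/-- The subspace of those `X` in the complement of `[s, s]` for which `ad(X)|_[s,s]` is
skew-symmetric. -/
def skewPart (Q : LinearMap.BilinForm ℝ s) : Submodule ℝ s where
  carrier := {X | X ∈ complement Q ∧ IsSkew (restrictDerived Q) (adDerived s X)}
  zero_mem' := ⟨Submodule.zero_mem _, fun x y => by simp⟩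
  add_mem' := by
    rintro X Y ⟨hX, hX'⟩ ⟨hY, hY'⟩
    refine ⟨Submodule.add_mem _ hX hY, fun x y => ?_⟩
    have h1 := hX' x y
    have h2 := hY' x y
    simp only [map_add, LinearMap.add_apply] at h1 h2 ⊢
    linarith
  smul_mem' := by
    rintro c X ⟨hX, hX'⟩
    refine ⟨Submodule.smul_mem _ c hX, fun x y => ?_⟩
    have h1 := hX' x y
    simp only [map_smul, LinearMap.smul_apply, smul_eq_mul] at h1 ⊢
    rw [h1]
    ring

/-- The linear form `Z ↦ (1/2) (Q([X,Y], Z) - Q([Y,Z], X) + Q([Z,X], Y))`. -/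
noncomputable def koszul (Q : LinearMap.BilinForm ℝ s) (X Y : s) : Module.Dual ℝ s where
  toFun Z := (1 / 2 : ℝ) * (Q ⁅X, Y⁆ Z - Q ⁅Y, Z⁆ X + Q ⁅Z, X⁆ Y)
  map_add' Z W := by
    simp only [lie_add, add_lie, map_add, LinearMap.add_apply]
    ring
  map_smul' c Z := by
    simp only [lie_smul, smul_lie, map_smul, LinearMap.smul_apply, smul_eq_mul, RingHom.id_apply]
    ring

variable [FiniteDimensional ℝ s]

/-- The Levi-Civita connection of the left-invariant metric `Q`, on left-invariant vector fields:
`leviCivita hQ X Y` is `∇_X Y`, given by the Koszul formula. -/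
noncomputable def leviCivita {Q : LinearMap.BilinForm ℝ s} (hQ : IsInnerProduct Q) :
    s →ₗ[ℝ] Module.End ℝ s :=
  LinearMap.mk₂ ℝ (fun X Y => (Q.toDual hQ.nondegenerate).symm (koszul Q X Y))
    (fun X X' Y => by
      rw [← map_add]
      congr 1
      ext Z
      simp only [koszul, LinearMap.coe_mk, AddHom.coe_mk, lie_add, add_lie, map_add,
        LinearMap.add_apply]
      ring)
    (fun c X Y => by
      rw [← map_smul]
      congr 1
      ext Z
      simp only [koszul, LinearMap.coe_mk, AddHom.coe_mk, lie_smul, smul_lie, map_smul,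
        LinearMap.smul_apply, smul_eq_mul]
      ring)
    (fun X Y Y' => by
      rw [← map_add]
      congr 1
      ext Z
      simp only [koszul, LinearMap.coe_mk, AddHom.coe_mk, lie_add, add_lie, map_add,
        LinearMap.add_apply]
      ring)
    (fun c X Y => by
      rw [← map_smul]
      congr 1
      ext Z
      simp only [koszul, LinearMap.coe_mk, AddHom.coe_mk, lie_smul, smul_lie, map_smul,
        LinearMap.smul_apply, smul_eq_mul]
      ring)

/-- The curvature operator `R(X, Y) = ∇_X ∇_Y - ∇_Y ∇_X - ∇_[X,Y]`. -/
noncomputable def curvature {Q : LinearMap.BilinForm ℝ s} (hQ : IsInnerProduct Q) (X Y : s) :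
    Module.End ℝ s :=
  leviCivita hQ X ∘ₗ leviCivita hQ Y - leviCivita hQ Y ∘ₗ leviCivita hQ X - leviCivita hQ ⁅X, Y⁆

/-- The operator `Z ↦ R(Z, X) Y`. -/
noncomputable def curvatureMap {Q : LinearMap.BilinForm ℝ s} (hQ : IsInnerProduct Q) (X Y : s) :
    Module.End ℝ s where
  toFun Z := curvature hQ Z X Y
  map_add' Z W := by
    simp only [curvature, add_lie, map_add, LinearMap.add_apply, LinearMap.sub_apply,
      LinearMap.comp_apply]
    abel
  map_smul' c Z := by
    simp only [curvature, smul_lie, map_smul, LinearMap.smul_apply, LinearMap.sub_apply,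
      LinearMap.comp_apply, RingHom.id_apply, smul_sub]

/-- The Ricci form `Ric(X, Y) = trace (Z ↦ R(Z, X) Y)`. -/
noncomputable def ricciForm {Q : LinearMap.BilinForm ℝ s} (hQ : IsInnerProduct Q) :
    LinearMap.BilinForm ℝ s :=
  LinearMap.mk₂ ℝ (fun X Y => LinearMap.trace ℝ s (curvatureMap hQ X Y))
    (fun X X' Y => by
      rw [← map_add]
      congr 1
      ext Z
      simp only [curvatureMap, LinearMap.coe_mk, AddHom.coe_mk, curvature, lie_add, map_add,
        LinearMap.add_apply, LinearMap.sub_apply, LinearMap.comp_apply]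
      abel)
    (fun c X Y => by
      rw [← map_smul]
      congr 1
      ext Z
      simp only [curvatureMap, LinearMap.coe_mk, AddHom.coe_mk, curvature, lie_smul, map_smul,
        LinearMap.smul_apply, LinearMap.sub_apply, LinearMap.comp_apply, smul_sub])
    (fun X Y Y' => by
      rw [← map_add]
      congr 1
      ext Z
      simp only [curvatureMap, LinearMap.coe_mk, AddHom.coe_mk, map_add, LinearMap.add_apply])
    (fun c X Y => by
      rw [← map_smul]
      congr 1
      ext Z
      simp only [curvatureMap, LinearMap.coe_mk, AddHom.coe_mk, map_smul, LinearMap.smul_apply])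

/-- The Ricci operator, determined by `Q (Ric X) Y = Ric(X, Y)`. -/
noncomputable def ricciOperator {Q : LinearMap.BilinForm ℝ s} (hQ : IsInnerProduct Q) :
    Module.End ℝ s :=
  (Q.toDual hQ.nondegenerate).symm.toLinearMap ∘ₗ ricciForm hQ

/-- The eigenvalues of the Ricci operator, listed with multiplicity. -/
noncomputable def ricciEigenvalues {Q : LinearMap.BilinForm ℝ s} (hQ : IsInnerProduct Q) :
    Multiset ℝ :=
  (ricciOperator hQ).charpoly.roots

/-- Case (1): `n = [s, s]` is commutative, its orthogonal complement `a` is a commutative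
subalgebra, and `ad(X)|_n` is skew-symmetric for all `X` in `a`. -/
def CaseOne (Q : LinearMap.BilinForm ℝ s) : Prop :=
  IsLieAbelian (derived s) ∧
  (∀ X ∈ complement Q, ∀ Y ∈ complement Q, ⁅X, Y⁆ = 0) ∧
  ∀ X ∈ complement Q, IsSkew (restrictDerived Q) (adDerived s X)

/-- Case (2): `n` is commutative, `a` is a commutative subalgebra, `ad(X)|_n` is trace-free and
normal for all `X` in `a`, and the skew-acting part of `a` has codimension 1 in `a`. -/
def CaseTwo (Q : LinearMap.BilinForm ℝ s) : Prop :=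
  IsLieAbelian (derived s) ∧
  (∀ X ∈ complement Q, ∀ Y ∈ complement Q, ⁅X, Y⁆ = 0) ∧
  (∀ X ∈ complement Q, LinearMap.trace ℝ (derived s) (adDerived s X) = 0 ∧
    IsNormal (restrictDerived Q) (adDerived s X)) ∧
  Module.finrank ℝ (skewPart Q) + 1 = Module.finrank ℝ (complement Q)

/-- Case (3): the Ricci operator has at least two negative eigenvalues, with multiplicity. -/
def CaseThree {Q : LinearMap.BilinForm ℝ s} (hQ : IsInnerProduct Q) : Prop :=
  2 ≤ ((ricciEigenvalues hQ).filter (· < 0)).card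

end

end MetricLie

/-! ### Nilpotency of the derived algebra, and a criterion for commutativity. -/

open scoped TensorProduct

/-! Write n = [s, s], a for its orthogonal complement, and S(X) for the symmetric part of ad(X)|_n.
If Ric is negative definite on a plane, then it has two negative eigenvalues
(`IsInnerProduct.two_le_card_neg_roots`). So when (3) fails, any two vectors u, v have a nontrivial
combination on which Ric ≥ 0 (`exists_ricciForm_nonneg`). The classification comes from feeding
well-chosen pairs into this principle.

For A in a one has Ric(A, A) = -|S(A)|² - (1/2) ∑ |[A, a_k]|². Pairs in a therefore show that a is
commutative and that S(a) has dimension at most one. Then Ric(A + Y, A + Y) = -|S(A + Y)|² + q(Y)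
for Y in n, where q is `ricciDefect`.

Suppose S(X) ≠ 0 for some X in a. Pairs (X, Y) give q ≥ 0 and an upper bound for |S(Y)|² - q(Y).
Summed over an orthonormal basis of n and compared with `IsAdapted.sum_sq_symPart_le`, this bound
forces tr ad(A)|_n = 0 for A in a. Now q, restricted to the complement of [n, n] in n, is
nonnegative with nonpositive trace, so it vanishes there. On that complement Ric(Y, Y) = -(1/2) ∑
|[Y, e_i]|², and pairs show that its elements commute. Since n is nilpotent (Lie's theorem), n is
then commutative. Finally q = 0 on all of n says that D = ad(X)|_n satisfies [D, D*] = 0, which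
gives (2).

If S vanishes on a, then q = 0 on the complement of [n, n] at once, and the same argument gives (1).

Conversely, in cases (1) and (2) q vanishes on n, so Ric(Z, Z) = -|S(Z)|². This is zero in case (1)
and a negative multiple of the square of one linear form in case (2). -/

theorem LieModule.isNilpotent_toEnd_of_mem_lie_top_top_of_isAlgClosed {K L : Type*} [Field K]
    [CharZero K] [IsAlgClosed K] [LieRing L] [LieAlgebra K L] [LieAlgebra.IsSolvable L]
    {M : Type*} [AddCommGroup M] [Module K M] [LieRingModule L M] [LieModule K L M]
    [FiniteDimensional K M] {y : L} (hy : y ∈ (⁅(⊤ : LieIdeal K L), (⊤ : LieIdeal K L)⁆)) :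
    _root_.IsNilpotent (LieModule.toEnd K L M y) := by
  induction hd : Module.finrank K M using Nat.strong_induction_on generalizing M with
  | _ d ih =>
    rcases subsingleton_or_nontrivial M with hM | hM
    · exact ⟨1, LinearMap.ext fun m => Subsingleton.elim _ _⟩
    obtain ⟨χ, hχ⟩ := LieModule.exists_nontrivial_weightSpace_of_isSolvable K L M
    obtain ⟨⟨v, hv⟩, hv0⟩ := exists_ne (0 : LieModule.weightSpace M χ)
    rw [LieModule.mem_weightSpace] at hv
    replace hv0 : v ≠ 0 := fun h => hv0 (Subtype.ext h)
    let N : LieSubmodule K L M :=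
      { toSubmodule := Submodule.span K {v}
        lie_mem := by
          intro x m hm
          obtain ⟨c, rfl⟩ := Submodule.mem_span_singleton.1 hm
          rw [lie_smul, hv]
          exact Submodule.smul_mem _ _ (Submodule.smul_mem _ _ (Submodule.mem_span_singleton_self v)) }
    -- A one-dimensional representation kills commutators, because scalars commute.
    have hyv : ⁅y, v⁆ = 0 := by
      rw [hv]
      have : χ y = 0 := by
        have hle : (⁅(⊤ : LieIdeal K L), (⊤ : LieIdeal K L)⁆).toSubmodule ≤ LinearMap.ker χ := by
          rw [LieSubmodule.lieIdeal_oper_eq_linear_span', Submodule.span_le]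
          rintro _ ⟨a, -, b, -, rfl⟩
          have h1 : ⁅⁅a, b⁆, v⁆ = 0 := by
            rw [lie_lie, hv b, hv a, lie_smul, lie_smul, hv, hv, smul_comm, sub_self]
          rw [hv] at h1
          exact (smul_eq_zero.1 h1).resolve_right hv0
        exact hle hy
      rw [this, zero_smul]
    have hlt : Module.finrank K (M ⧸ N.toSubmodule) < d := by
      have h1 := Submodule.finrank_quotient_add_finrank N.toSubmodule
      have h2 : Module.finrank K N.toSubmodule = 1 := finrank_span_singleton hv0
      omega
    obtain ⟨k, hk⟩ := ih _ hlt (M := M ⧸ N) rfl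
    -- The k-th power of y maps into the invariant line, and one further application of y kills that
    -- line.
    refine ⟨k + 1, LinearMap.ext fun m => ?_⟩
    have h3 : ∀ j : ℕ, ((LieModule.toEnd K L (M ⧸ N) y) ^ j) (LieSubmodule.Quotient.mk m) =
        LieSubmodule.Quotient.mk (((LieModule.toEnd K L M y) ^ j) m) := by
      intro j
      induction j with
      | zero => rfl
      | succ j ihj =>
        rw [pow_succ', pow_succ', Module.End.mul_apply, ihj, Module.End.mul_apply]
        rfl
    have h4 := h3 k
    rw [hk, LinearMap.zero_apply, eq_comm] at h4
    replace h4 := (LieSubmodule.Quotient.mk_eq_zero N).1 h4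
    obtain ⟨c, hc⟩ := Submodule.mem_span_singleton.1 h4
    rw [pow_succ', Module.End.mul_apply, ← hc, map_smul, LieModule.toEnd_apply_apply, hyv,
      smul_zero, LinearMap.zero_apply]

/-- Extending scalars to the algebraic closure preserves solvability and the derived algebra;
nilpotency descends because M embeds in its base change. -/
theorem LieModule.isNilpotent_toEnd_of_mem_lie_top_top {K L M : Type*} [Field K]
    [CharZero K] [LieRing L] [LieAlgebra K L] [LieAlgebra.IsSolvable L]
    [AddCommGroup M] [Module K M] [LieRingModule L M] [LieModule K L M]
    [FiniteDimensional K M] {y : L} (hy : y ∈ (⁅(⊤ : LieIdeal K L), (⊤ : LieIdeal K L)⁆)) :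
    _root_.IsNilpotent (LieModule.toEnd K L M y) := by
  have h1 : (1 : AlgebraicClosure K) ⊗ₜ[K] y ∈
      (⁅(⊤ : LieIdeal (AlgebraicClosure K) (AlgebraicClosure K ⊗[K] L)),
        (⊤ : LieIdeal (AlgebraicClosure K) (AlgebraicClosure K ⊗[K] L))⁆) := by
    have := LieSubmodule.tmul_mem_baseChange_of_mem (A := AlgebraicClosure K) 1 hy
    rwa [LieSubmodule.lie_baseChange, LieSubmodule.baseChange_top] at this
  have h2 := LieModule.isNilpotent_toEnd_of_mem_lie_top_top_of_isAlgClosed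
    (M := AlgebraicClosure K ⊗[K] M) h1
  rw [LieModule.toEnd_baseChange] at h2
  obtain ⟨k, hk⟩ := h2
  refine ⟨k, ?_⟩
  rw [← LinearMap.baseChange_pow] at hk
  refine LinearMap.ext fun m => ?_
  have h3 := LinearMap.congr_fun hk (1 ⊗ₜ m)
  rw [LinearMap.baseChange_tmul, LinearMap.zero_apply] at h3
  have hinj := Module.Flat.rTensor_preserves_injective_linearMap (M := M)
    (Algebra.linearMap K (AlgebraicClosure K)) (algebraMap K (AlgebraicClosure K)).injective
  have h4 : (1 : K) ⊗ₜ[K] ((LieModule.toEnd K L M y ^ k) m) = 0 :=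
    hinj (by simpa using h3)
  simpa using congrArg (TensorProduct.lid K M) h4

theorem LieAlgebra.isNilpotent_lie_top_top {K L : Type*} [Field K] [CharZero K] [LieRing L]
    [LieAlgebra K L] [LieAlgebra.IsSolvable L] [FiniteDimensional K L] :
    LieRing.IsNilpotent (⁅(⊤ : LieIdeal K L), (⊤ : LieIdeal K L)⁆ : LieIdeal K L) :=
  (LieAlgebra.isNilpotent_iff_forall (R := K)).2 fun y =>
    LieModule.isNilpotent_toEnd_of_mem_lie_top_top (L := L) (y := (y : L))
      (M := (⁅(⊤ : LieIdeal K L), (⊤ : LieIdeal K L)⁆ : LieIdeal K L)) y.2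

/-- If L = v + D with D = [L, L] and v commuting, then D ⊆ [L, D]. So D lies in every term of the
lower central series, which reaches zero. -/
theorem LieAlgebra.isLieAbelian_of_isNilpotent_of_commuting_generators {K L : Type*} [CommRing K]
    [LieRing L] [LieAlgebra K L] [LieRing.IsNilpotent L] (v : Set L)
    (hv : ∀ x : L, ∃ a ∈ v, x - a ∈ (⁅(⊤ : LieIdeal K L), (⊤ : LieIdeal K L)⁆))
    (hc : ∀ a ∈ v, ∀ b ∈ v, ⁅a, b⁆ = 0) : IsLieAbelian L := by
  set D : LieIdeal K L := ⁅(⊤ : LieIdeal K L), (⊤ : LieIdeal K L)⁆ with hD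
  have h1 : D ≤ ⁅(⊤ : LieIdeal K L), D⁆ := by
    rw [hD, LieSubmodule.lie_le_iff]
    intro x _ y _
    obtain ⟨a, ha, hxa⟩ := hv x
    obtain ⟨b, hb, hyb⟩ := hv y
    have h2 : ⁅x, y⁆ = ⁅x, y - b⁆ - ⁅b, x - a⁆ := by
      rw [lie_sub, lie_sub, hc b hb a ha, ← lie_skew x b]
      abel
    rw [h2]
    exact sub_mem (LieSubmodule.lie_mem_lie (LieSubmodule.mem_top _) hyb)
      (LieSubmodule.lie_mem_lie (LieSubmodule.mem_top _) hxa)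
  have h2 : ∀ k, D ≤ LieModule.lowerCentralSeries K L L k := by
    intro k
    induction k with
    | zero => simp
    | succ k ih =>
      rw [LieModule.lowerCentralSeries_succ]
      exact h1.trans (LieSubmodule.mono_lie_right _ ih)
  obtain ⟨k, hk⟩ := (LieModule.isNilpotent_iff K L L).1 inferInstance
  have h3 : D = ⊥ := le_bot_iff.1 (hk ▸ h2 k)
  refine ⟨fun x y => ?_⟩
  have h4 : ⁅x, y⁆ ∈ D := LieSubmodule.lie_mem_lie (LieSubmodule.mem_top _) (LieSubmodule.mem_top _)
  rwa [h3, LieSubmodule.mem_bot] at h4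

/-! ### Orthonormal bases, and counting negative eigenvalues. -/

namespace MetricLie

section InnerProduct

variable {V : Type*} [AddCommGroup V] [Module ℝ V] {Q : LinearMap.BilinForm ℝ V}

/-- The family `e` is orthonormal with respect to `Q`. -/
def IsOrthonormalFamily {ι : Type*} [DecidableEq ι] (Q : LinearMap.BilinForm ℝ V) (e : ι → V) :
    Prop :=
  ∀ i j, Q (e i) (e j) = if i = j then 1 else 0

theorem IsInnerProduct.nonneg (hQ : IsInnerProduct Q) (x : V) : 0 ≤ Q x x := by
  rcases eq_or_ne x 0 with rfl | hx
  · simp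
  · exact (hQ.pos x hx).le

theorem IsInnerProduct.eq_zero (hQ : IsInnerProduct Q) {x : V} (h : Q x x = 0) : x = 0 := by
  by_contra hx
  exact (hQ.pos x hx).ne' h

theorem IsInnerProduct.restrict (hQ : IsInnerProduct Q) (W : Submodule ℝ V) :
    IsInnerProduct (Q.restrict W) :=
  ⟨fun x y => hQ.symm x y, fun x hx => hQ.pos x fun h => hx (Subtype.ext h)⟩

theorem IsInnerProduct.ext (hQ : IsInnerProduct Q) {x y : V} (h : ∀ z, Q x z = Q y z) :
    x = y := by
  rw [← sub_eq_zero]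
  apply hQ.eq_zero
  rw [← sub_eq_zero.2 (h (x - y)), map_sub Q, LinearMap.sub_apply]

/-- The inner product space structure given by `Q`. -/
abbrev IsInnerProduct.core (hQ : IsInnerProduct Q) : InnerProductSpace.Core ℝ V where
  inner x y := Q x y
  conj_inner_symm x y := by simpa using hQ.symm y x
  re_inner_nonneg x := by simpa using hQ.nonneg x
  add_left x y z := by simp
  smul_left x y r := by simp
  definite x h := hQ.eq_zero h

theorem IsInnerProduct.exists_orthonormal_basis [FiniteDimensional ℝ V] (hQ : IsInnerProduct Q) :
    ∃ b : Module.Basis (Fin (Module.finrank ℝ V)) ℝ V, IsOrthonormalFamily Q b := by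
  let _ : NormedAddCommGroup V := hQ.core.toNormedAddCommGroup
  let _ : InnerProductSpace ℝ V := InnerProductSpace.ofCore hQ.core.toCore
  refine ⟨(stdOrthonormalBasis ℝ V).toBasis, fun i j => ?_⟩
  rw [OrthonormalBasis.coe_toBasis]
  exact orthonormal_iff_ite.1 (stdOrthonormalBasis ℝ V).orthonormal i j

theorem IsInnerProduct.exists_adjoint [FiniteDimensional ℝ V] (hQ : IsInnerProduct Q)
    (A : Module.End ℝ V) : ∃ A' : Module.End ℝ V, ∀ x y, Q (A x) y = Q x (A' y) := by
  let _ : NormedAddCommGroup V := hQ.core.toNormedAddCommGroup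
  let _ : InnerProductSpace ℝ V := InnerProductSpace.ofCore hQ.core.toCore
  exact ⟨LinearMap.adjoint A, fun x y => (LinearMap.adjoint_inner_right A x y).symm⟩

theorem IsInnerProduct.exists_eigenbasis [FiniteDimensional ℝ V] (hQ : IsInnerProduct Q)
    {T : Module.End ℝ V} (hT : ∀ x y, Q (T x) y = Q x (T y)) :
    ∃ (b : Module.Basis (Fin (Module.finrank ℝ V)) ℝ V) (l : Fin (Module.finrank ℝ V) → ℝ),
      IsOrthonormalFamily Q b ∧ (∀ i, T (b i) = l i • b i) ∧
      T.charpoly.roots = Multiset.map l Finset.univ.val := by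
  let _ : NormedAddCommGroup V := hQ.core.toNormedAddCommGroup
  let _ : InnerProductSpace ℝ V := InnerProductSpace.ofCore hQ.core.toCore
  have hS : T.IsSymmetric := hT
  refine ⟨(hS.eigenvectorBasis rfl).toBasis, hS.eigenvalues rfl, fun i j => ?_, fun i => ?_, ?_⟩
  · rw [OrthonormalBasis.coe_toBasis]
    exact orthonormal_iff_ite.1 (hS.eigenvectorBasis rfl).orthonormal i j
  · rw [OrthonormalBasis.coe_toBasis]
    exact hS.apply_eigenvectorBasis rfl i
  · simpa [Function.comp_def] using hS.roots_charpoly_eq_eigenvalues rfl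

section Expansion

variable {ι : Type*} [Fintype ι] [DecidableEq ι] {e : Module.Basis ι ℝ V}

theorem IsOrthonormalFamily.repr_eq (he : IsOrthonormalFamily Q e) (x : V) (i : ι) :
    e.repr x i = Q x (e i) := by
  have h : Q (∑ j, e.repr x j • e j) (e i) = e.repr x i := by
    rw [map_sum, LinearMap.sum_apply]
    simp [he _ i]
  rw [← h, e.sum_repr]

theorem IsOrthonormalFamily.sum_smul (he : IsOrthonormalFamily Q e) (x : V) :
    ∑ i, Q x (e i) • e i = x := by
  simp [← he.repr_eq]

theorem IsOrthonormalFamily.sum_mul (he : IsOrthonormalFamily Q e) (x y : V) :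
    ∑ i, Q x (e i) * Q (e i) y = Q x y := by
  conv_rhs => rw [← he.sum_smul x, map_sum, LinearMap.sum_apply]
  simp

theorem IsOrthonormalFamily.trace_eq (he : IsOrthonormalFamily Q e) (A : Module.End ℝ V) :
    LinearMap.trace ℝ V A = ∑ i, Q (A (e i)) (e i) := by
  rw [LinearMap.trace_eq_matrix_trace ℝ e, Matrix.trace]
  simp [LinearMap.toMatrix_apply, he.repr_eq]

end Expansion

/-- The basis of `W` is prescribed, so that two applications produce a basis adapted to a flag. -/
theorem IsInnerProduct.exists_adapted_basis [FiniteDimensional ℝ V] (hQ : IsInnerProduct Q)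
    (W : Submodule ℝ V) {n : Type*} [Fintype n] [DecidableEq n] (b : Module.Basis n ℝ W)
    (hb : IsOrthonormalFamily (Q.restrict W) b) :
    ∃ (m : ℕ) (e : Module.Basis (Fin m ⊕ n) ℝ V), IsOrthonormalFamily Q e ∧
      (∀ k, ∀ w ∈ W, Q w (e (Sum.inl k)) = 0) ∧ ∀ i, e (Sum.inr i) = b i := by
  have hrefl : Q.IsRefl := fun x y h => by rw [hQ.symm, h]
  have hc : IsCompl W (Q.orthogonal W) :=
    (LinearMap.BilinForm.restrict_nondegenerate_iff_isCompl_orthogonal hrefl).1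
      (hQ.restrict W).nondegenerate
  obtain ⟨c, hcb⟩ := (hQ.restrict (Q.orthogonal W)).exists_orthonormal_basis
  let e := (c.prod b).map (Submodule.prodEquivOfIsCompl _ _ hc.symm)
  have hl : ∀ k, e (Sum.inl k) = c k := fun k => by simp [e]
  have hr : ∀ i, e (Sum.inr i) = b i := fun i => by simp [e]
  have hlw : ∀ k, ∀ w ∈ W, Q w (c k) = 0 := fun k w hw => (c k).2 w hw
  refine ⟨_, e, ?_, fun k w hw => by rw [hl]; exact hlw k w hw, hr⟩
  rintro (i | i) (j | j)
  · rw [hl, hl]; simpa using hcb i j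
  · rw [hl, hr, hQ.symm, hlw i _ (b j).2]; simp
  · rw [hl, hr, hlw j _ (b i).2]; simp
  · rw [hr, hr]; simpa using hb i j

/-- With at most one negative eigenvalue, the form is nonnegative on the orthogonal complement of
that eigenvector, and this hyperplane meets every plane nontrivially. -/
theorem IsInnerProduct.two_le_card_neg_roots [FiniteDimensional ℝ V] (hQ : IsInnerProduct Q)
    {T : Module.End ℝ V} (hT : ∀ x y, Q (T x) y = Q x (T y)) (u v : V)
    (h : ∀ x y : ℝ, (x ≠ 0 ∨ y ≠ 0) → Q (T (x • u + y • v)) (x • u + y • v) < 0) :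
    2 ≤ (T.charpoly.roots.filter (· < 0)).card := by
  obtain ⟨b, l, hb, hl, hroots⟩ := hQ.exists_eigenbasis hT
  have hform : ∀ z, Q (T z) z = ∑ i, l i * (Q z (b i)) ^ 2 := by
    intro z
    rw [← hb.sum_mul (T z) z]
    refine Finset.sum_congr rfl fun i _ => ?_
    rw [hT, hl, map_smul, hQ.symm (b i) z, smul_eq_mul]
    ring
  rw [hroots, Multiset.filter_map, Multiset.card_map]
  change 2 ≤ (Finset.univ.filter fun i => l i < 0).card
  by_contra hlt
  have hle : (Finset.univ.filter fun i => l i < 0).card ≤ 1 := by omega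
  rw [Finset.card_le_one] at hle
  have hnn : ∀ z, (∀ i, l i < 0 → Q z (b i) = 0) → 0 ≤ Q (T z) z := by
    intro z hz
    rw [hform]
    refine Finset.sum_nonneg fun i _ => ?_
    rcases lt_or_ge (l i) 0 with hi | hi
    · rw [hz i hi]; simp
    · positivity
  by_cases hex : ∃ i, l i < 0
  · obtain ⟨i, hi⟩ := hex
    have hz : ∀ z, Q z (b i) = 0 → 0 ≤ Q (T z) z := fun z hz => hnn z fun j hj => by
      rw [hle j (by simpa using hj) i (by simpa using hi), hz]
    by_cases hu : Q u (b i) = 0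
    · have := h 1 0 (by simp)
      have h2 := hz u hu
      simp only [one_smul, zero_smul, add_zero] at this
      linarith
    -- The coefficients make the combination of u and v orthogonal to the negative eigenvector.
    · have h1 := h (-Q v (b i)) (Q u (b i)) (Or.inr hu)
      have h2 := hz (-Q v (b i) • u + Q u (b i) • v) (by
        simp only [map_add, map_smul, LinearMap.add_apply, LinearMap.smul_apply, smul_eq_mul]
        ring)
      linarith
  · push Not at hex
    have h1 := h 1 0 (by simp)
    have h2 := hnn (1 • u + 0 • v) fun i hi => absurd hi (not_lt.2 (hex i))
    simp only [one_smul, zero_smul, add_zero] at h1 h2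
    linarith

end InnerProduct

theorem IsInnerProduct.roots_eq_cons_replicate {V : Type*} [AddCommGroup V] [Module ℝ V]
    {Q : LinearMap.BilinForm ℝ V} [FiniteDimensional ℝ V] (hQ : IsInnerProduct Q)
    {T : Module.End ℝ V} {f : Module.Dual ℝ V} {c : ℝ} (hc : c < 0) (hf : f ≠ 0)
    (hT : ∀ x y, Q (T x) y = c * (f x * f y)) :
    ∃ c' : ℝ, c' < 0 ∧
      T.charpoly.roots = c' ::ₘ Multiset.replicate (Module.finrank ℝ V - 1) 0 := by
  obtain ⟨b, l, hb, hl, hroots⟩ := hQ.exists_eigenbasis (T := T) (fun x y => by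
    rw [hT, hQ.symm, hT, mul_comm (f x)])
  have h1 : ∀ i j, c * (f (b i) * f (b j)) = if i = j then l i else 0 := by
    intro i j
    rw [← hT, hl, map_smul, LinearMap.smul_apply, hb]
    simp
  obtain ⟨i, hi⟩ : ∃ i, f (b i) ≠ 0 := by
    by_contra hall
    push Not at hall
    exact hf (b.ext fun i => by simp [hall i])
  refine ⟨l i, ?_, ?_⟩
  · have := h1 i i
    rw [if_pos rfl] at this
    rw [← this]
    exact mul_neg_of_neg_of_pos hc (mul_self_pos.2 hi)
  · have h0 : ∀ j, j ≠ i → l j = 0 := by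
      intro j hj
      have h2 := h1 i j
      rw [if_neg hj.symm] at h2
      have h3 : f (b j) = 0 := by
        rcases mul_eq_zero.1 h2 with h | h
        · exact absurd h hc.ne
        · exact (mul_eq_zero.1 h).resolve_left hi
      have h4 := h1 j j
      rw [if_pos rfl, h3] at h4
      simpa using h4.symm
    rw [hroots, ← Finset.insert_erase (Finset.mem_univ i),
      Finset.insert_val_of_notMem (Finset.notMem_erase i _), Multiset.map_cons]
    congr 1
    rw [Multiset.eq_replicate]
    refine ⟨?_, ?_⟩
    · rw [Multiset.card_map, Finset.card_val, Finset.card_erase_of_mem (Finset.mem_univ i)]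
      simp
    · intro x hx
      obtain ⟨j, hj, rfl⟩ := Multiset.mem_map.1 hx
      exact h0 j (Finset.ne_of_mem_erase (Finset.mem_def.2 hj))

end MetricLie

/-! ### The Ricci form in an orthonormal basis. -/

theorem Finset.sum_sum_eq_of_add_swap_eq {ι : Type*} [Fintype ι] {f g : ι → ι → ℝ}
    (h : ∀ i j, f i j + f j i = g i j + g j i) : ∑ i, ∑ j, f i j = ∑ i, ∑ j, g i j := by
  have h1 : ∑ i, ∑ j, (f i j + f j i) = ∑ i, ∑ j, (g i j + g j i) := by simp only [h]
  have h2 : ∀ k : ι → ι → ℝ, ∑ i, ∑ j, (k i j + k j i) = 2 * ∑ i, ∑ j, k i j := by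
    intro k
    simp only [Finset.sum_add_distrib]
    rw [Finset.sum_comm (f := fun i j => k j i)]
    ring
  rw [h2, h2] at h1
  linarith

namespace MetricLie

theorem trace_ad {s : Type*} [LieRing s] [LieAlgebra ℝ s] {Q : LinearMap.BilinForm ℝ s}
    {ι : Type*} [Fintype ι] [DecidableEq ι] {e : Module.Basis ι ℝ s}
    (he : IsOrthonormalFamily Q e) (X : s) :
    LinearMap.trace ℝ s (LieAlgebra.ad ℝ s X) = ∑ i, Q ⁅X, e i⁆ (e i) := by
  rw [he.trace_eq]
  rfl

section Ricci

variable {s : Type*} [LieRing s] [LieAlgebra ℝ s] [FiniteDimensional ℝ s]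
  {Q : LinearMap.BilinForm ℝ s}

theorem leviCivita_apply (hQ : IsInnerProduct Q) (X Y Z : s) :
    Q (leviCivita hQ X Y) Z = (1 / 2 : ℝ) * (Q ⁅X, Y⁆ Z - Q ⁅Y, Z⁆ X + Q ⁅Z, X⁆ Y) :=
  LinearMap.BilinForm.apply_toDual_symm_apply (hB := hQ.nondegenerate) (koszul Q X Y) Z

theorem ricciOperator_apply (hQ : IsInnerProduct Q) (X Y : s) :
    Q (ricciOperator hQ X) Y = ricciForm hQ X Y :=
  LinearMap.BilinForm.apply_toDual_symm_apply (hB := hQ.nondegenerate) (ricciForm hQ X) Y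

theorem leviCivita_skew (hQ : IsInnerProduct Q) (X Y Z : s) :
    Q (leviCivita hQ X Y) Z = -Q Y (leviCivita hQ X Z) := by
  rw [hQ.symm Y, leviCivita_apply, leviCivita_apply, ← lie_skew Z Y, ← lie_skew X Z,
    ← lie_skew Y X]
  simp only [map_neg, LinearMap.neg_apply]
  ring

variable {ι : Type*} [Fintype ι] [DecidableEq ι] {e : Module.Basis ι ℝ s}

/-- Both sides represent the linear form Z ↦ tr ad(Z) with respect to `Q`. -/
theorem sum_leviCivita_self (hQ : IsInnerProduct Q) (he : IsOrthonormalFamily Q e) :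
    ∑ i, leviCivita hQ (e i) (e i) = ∑ k, (∑ i, Q ⁅e k, e i⁆ (e i)) • e k := by
  refine hQ.ext fun Z => ?_
  simp only [← trace_ad he]
  have h1 : LinearMap.trace ℝ s (LieAlgebra.ad ℝ s Z) = ∑ k, Q (e k) Z *
      LinearMap.trace ℝ s (LieAlgebra.ad ℝ s (e k)) := by
    conv_lhs => rw [← he.sum_smul Z]
    simp only [map_sum, map_smul, smul_eq_mul, hQ.symm Z]
  calc Q (∑ i, leviCivita hQ (e i) (e i)) Z
      = ∑ i, Q ⁅Z, e i⁆ (e i) := by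
        rw [map_sum, LinearMap.sum_apply]
        refine Finset.sum_congr rfl fun i _ => ?_
        rw [leviCivita_apply, lie_self, ← lie_skew (e i) Z]
        simp only [map_neg, LinearMap.neg_apply, map_zero, LinearMap.zero_apply]
        ring
    _ = _ := by
        rw [← trace_ad he, h1, map_sum, LinearMap.sum_apply]
        refine Finset.sum_congr rfl fun k _ => ?_
        rw [map_smul, LinearMap.smul_apply, smul_eq_mul, mul_comm]

/-- Skewness of ∇_X moves every connection term of R(e_i, X)Y onto products of first-order
expressions, which the Koszul formula evaluates. The final sum is the contribution of the vector
dual to tr ad. -/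
theorem ricciForm_eq_sum (hQ : IsInnerProduct Q) (he : IsOrthonormalFamily Q e) (X Y : s) :
    ricciForm hQ X Y = (∑ i, ∑ j, ((1 / 4) * (Q ⁅e i, e j⁆ X * Q ⁅e i, e j⁆ Y)
        - (1 / 2) * (Q ⁅X, e i⁆ (e j) * Q ⁅Y, e i⁆ (e j))
        - (1 / 2) * (Q ⁅X, e i⁆ (e j) * Q ⁅Y, e j⁆ (e i))))
      - ∑ k, (∑ i, Q ⁅e k, e i⁆ (e i)) * ((1 / 2) * (Q ⁅e k, X⁆ Y + Q ⁅e k, Y⁆ X)) := by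
  have h1 : ricciForm hQ X Y = ∑ i, Q (curvature hQ (e i) X Y) (e i) := he.trace_eq _
  have h2 : ∀ i, Q (curvature hQ (e i) X Y) (e i) =
      -Q (leviCivita hQ X Y) (leviCivita hQ (e i) (e i)) +
      ∑ j, ((1 / 2 * (-Q ⁅Y, e i⁆ (e j) - Q ⁅Y, e j⁆ (e i) - Q ⁅e i, e j⁆ Y)) *
          (1 / 2 * (Q ⁅X, e i⁆ (e j) - Q ⁅X, e j⁆ (e i) - Q ⁅e i, e j⁆ X)) +
        Q ⁅X, e i⁆ (e j) * (1 / 2 * (-Q ⁅Y, e j⁆ (e i) - Q ⁅Y, e i⁆ (e j) - Q ⁅e j, e i⁆ Y))) := by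
    intro i
    have h3 : ∀ i j, Q (leviCivita hQ (e i) Y) (e j) =
        1 / 2 * (-Q ⁅Y, e i⁆ (e j) - Q ⁅Y, e j⁆ (e i) - Q ⁅e i, e j⁆ Y) := by
      intro i j
      rw [leviCivita_apply, ← lie_skew (e i) Y, ← lie_skew (e j) (e i)]
      simp only [map_neg, LinearMap.neg_apply]
      ring
    have h4 : ∀ j, Q (e j) (leviCivita hQ X (e i)) =
        1 / 2 * (Q ⁅X, e i⁆ (e j) - Q ⁅X, e j⁆ (e i) - Q ⁅e i, e j⁆ X) := by
      intro j
      rw [hQ.symm, leviCivita_apply, ← lie_skew (e j) X]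
      simp only [map_neg, LinearMap.neg_apply]
      ring
    have h5 : leviCivita hQ ⁅e i, X⁆ Y = -∑ j, Q ⁅X, e i⁆ (e j) • leviCivita hQ (e j) Y := by
      conv_lhs => rw [← lie_skew, ← he.sum_smul ⁅X, e i⁆]
      simp only [map_neg, map_sum, map_smul, LinearMap.neg_apply, LinearMap.sum_apply,
        LinearMap.smul_apply]
    simp only [curvature, LinearMap.sub_apply, LinearMap.comp_apply, map_sub]
    rw [leviCivita_skew hQ (e i), leviCivita_skew hQ X (leviCivita hQ (e i) Y),
      ← he.sum_mul (leviCivita hQ (e i) Y), h5, map_neg, map_sum, LinearMap.neg_apply,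
      LinearMap.sum_apply, Finset.sum_add_distrib]
    simp only [map_smul, LinearMap.smul_apply, smul_eq_mul, h3, h4]
    ring
  have h6 : ∑ i, Q (leviCivita hQ X Y) (leviCivita hQ (e i) (e i)) =
      ∑ k, (∑ i, Q ⁅e k, e i⁆ (e i)) * ((1 / 2) * (Q ⁅e k, X⁆ Y + Q ⁅e k, Y⁆ X)) := by
    rw [← map_sum, sum_leviCivita_self hQ he, map_sum]
    have h7 : ∀ k, Q (leviCivita hQ X Y) ((∑ i, Q ⁅e k, e i⁆ (e i)) • e k) =
        (∑ i, Q ⁅e k, e i⁆ (e i)) * ((1 / 2) * (Q ⁅e k, X⁆ Y + Q ⁅e k, Y⁆ X)) +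
        1 / 2 * (Q ⁅X, Y⁆ (e k) * ∑ i, Q ⁅e k, e i⁆ (e i)) := by
      intro k
      rw [map_smul, leviCivita_apply, ← lie_skew Y (e k), smul_eq_mul]
      simp only [map_neg, LinearMap.neg_apply]
      ring
    -- This sum is tr ad([X, Y]), the trace of a commutator; its vanishing leaves an expression
    -- symmetric in X and Y.
    have h8 : ∑ k, Q ⁅X, Y⁆ (e k) * ∑ i, Q ⁅e k, e i⁆ (e i) = 0 := by
      have : LinearMap.trace ℝ s (LieAlgebra.ad ℝ s ⁅X, Y⁆) = 0 := by
        have hlie : LieAlgebra.ad ℝ s ⁅X, Y⁆ = LieAlgebra.ad ℝ s X * LieAlgebra.ad ℝ s Y -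
            LieAlgebra.ad ℝ s Y * LieAlgebra.ad ℝ s X := by
          ext Z
          simp
        rw [hlie, map_sub, LinearMap.trace_mul_comm, sub_self]
      rw [← he.sum_smul ⁅X, Y⁆] at this
      simpa only [map_sum, map_smul, smul_eq_mul, trace_ad he] using this
    simp only [h7, Finset.sum_add_distrib]
    rw [← Finset.mul_sum, h8]
    ring
  rw [h1]
  simp only [h2, Finset.sum_add_distrib (f := fun i => -Q _ _)]
  rw [Finset.sum_neg_distrib, h6, neg_add_eq_sub]
  congr 1
  -- The summands agree only after symmetrizing in i and j.
  refine Finset.sum_sum_eq_of_add_swap_eq fun i j => ?_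
  rw [← lie_skew (e j) (e i)]
  simp only [map_neg, LinearMap.neg_apply]
  ring

theorem ricciForm_symm (hQ : IsInnerProduct Q) (X Y : s) :
    ricciForm hQ X Y = ricciForm hQ Y X := by
  obtain ⟨b, hb⟩ := hQ.exists_orthonormal_basis
  rw [ricciForm_eq_sum hQ hb, ricciForm_eq_sum hQ hb]
  congr 1
  · refine Finset.sum_sum_eq_of_add_swap_eq fun i j => ?_
    ring
  · refine Finset.sum_congr rfl fun k _ => ?_
    ring

theorem ricciOperator_symm (hQ : IsInnerProduct Q) (X Y : s) :
    Q (ricciOperator hQ X) Y = Q X (ricciOperator hQ Y) := by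
  rw [hQ.symm X, ricciOperator_apply, ricciOperator_apply, ricciForm_symm]

theorem ricciForm_eq_of_forall_self (hQ : IsInnerProduct Q) (B : LinearMap.BilinForm ℝ s)
    (hB : ∀ X Y, B X Y = B Y X) (h : ∀ X, ricciForm hQ X X = B X X) : ricciForm hQ = B := by
  ext X Y
  have h1 := h (X + Y)
  simp only [map_add, LinearMap.add_apply, h] at h1
  rw [ricciForm_symm hQ Y X, hB Y X] at h1
  linarith

theorem caseThree_of_neg (hQ : IsInnerProduct Q) (u v : s)
    (h : ∀ x y : ℝ, (x ≠ 0 ∨ y ≠ 0) → ricciForm hQ (x • u + y • v) (x • u + y • v) < 0) :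
    CaseThree hQ :=
  hQ.two_le_card_neg_roots (ricciOperator_symm hQ) u v fun x y hxy => by
    rw [ricciOperator_apply]
    exact h x y hxy

end Ricci

end MetricLie

/-! ### Two inequalities from linear algebra. -/

/-- Nonzero singular values of a skew matrix occur in equal pairs, so the squared operator norm is
at most half the squared Frobenius norm. The proof expands 0 ≤ |W M - w ∧ u|² with W = |w|² and u =
Mᵀw. The gain of the factor 2 over Cauchy–Schwarz is essential later. -/
theorem two_mul_sum_sq_le_of_skew {ι : Type*} [Fintype ι] (M : ι → ι → ℝ)
    (hM : ∀ i j, M i j = -M j i) (w : ι → ℝ) :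
    2 * ∑ j, (∑ i, w i * M i j) ^ 2 ≤ (∑ i, ∑ j, M i j ^ 2) * ∑ i, w i ^ 2 := by
  set u : ι → ℝ := fun j => ∑ i, w i * M i j with hu
  set W := ∑ i, w i ^ 2 with hW
  have hW0 : 0 ≤ W := Finset.sum_nonneg fun i _ => sq_nonneg _
  rcases hW0.eq_or_lt with h0 | hpos
  · have hw : ∀ i, w i = 0 := fun i => by
      have := (Finset.sum_eq_zero_iff_of_nonneg (fun i _ => sq_nonneg (w i))).1 h0.symm i
        (Finset.mem_univ i)
      exact pow_eq_zero_iff two_ne_zero |>.1 this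
    rw [← h0]
    simp [hw]
  · have h1 : ∑ i, ∑ j, w i * u j * M i j = ∑ j, u j ^ 2 := by
      rw [Finset.sum_comm]
      refine Finset.sum_congr rfl fun j _ => ?_
      rw [pow_two]
      nth_rewrite 3 [hu]
      rw [Finset.mul_sum]
      exact Finset.sum_congr rfl fun i _ => by ring
    have h2 : ∑ i, ∑ j, w j * u i * M i j = -∑ j, u j ^ 2 := by
      rw [← h1, Finset.sum_comm, ← Finset.sum_neg_distrib]
      refine Finset.sum_congr rfl fun i _ => ?_
      rw [← Finset.sum_neg_distrib]
      exact Finset.sum_congr rfl fun j _ => by rw [hM j i]; ring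
    have h3 : ∑ i, ∑ j, (w i) ^ 2 * (u j) ^ 2 = W * ∑ j, u j ^ 2 := by
      rw [hW, Finset.sum_mul_sum]
    have h4 : ∑ i, ∑ j, (w j) ^ 2 * (u i) ^ 2 = W * ∑ j, u j ^ 2 := by
      rw [Finset.sum_comm, h3]
    have h5 : ∑ i, ∑ j, (w i * u i) * (w j * u j) = (∑ i, w i * u i) ^ 2 := by
      rw [pow_two, Finset.sum_mul_sum]
    have h6 : 0 ≤ ∑ i, ∑ j, (W * M i j - (w i * u j - w j * u i)) ^ 2 :=
      Finset.sum_nonneg fun i _ => Finset.sum_nonneg fun j _ => sq_nonneg _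
    have h7 : ∑ i, ∑ j, (W * M i j - (w i * u j - w j * u i)) ^ 2 =
        W ^ 2 * (∑ i, ∑ j, M i j ^ 2) - 2 * W * (∑ i, ∑ j, w i * u j * M i j)
        + 2 * W * (∑ i, ∑ j, w j * u i * M i j) + (∑ i, ∑ j, (w i) ^ 2 * (u j) ^ 2)
        + (∑ i, ∑ j, (w j) ^ 2 * (u i) ^ 2) - 2 * ∑ i, ∑ j, (w i * u i) * (w j * u j) := by
      simp only [Finset.mul_sum, ← Finset.sum_add_distrib, ← Finset.sum_sub_distrib]
      exact Finset.sum_congr rfl fun i _ => Finset.sum_congr rfl fun j _ => by ring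
    rw [h7, h1, h2, h3, h4, h5] at h6
    refine le_of_mul_le_mul_left ?_ hpos
    nlinarith [sq_nonneg (∑ i, w i * u i)]

theorem LinearMap.BilinForm.apply_self_eq_zero_of_trace_nonpos {V : Type*} [AddCommGroup V]
    [Module ℝ V] (B : LinearMap.BilinForm ℝ V) (hB : ∀ x y, B x y = B y x) {ι : Type*} [Fintype ι]
    (b : ι → V) (hnn : ∀ x ∈ Submodule.span ℝ (Set.range b), 0 ≤ B x x)
    (htr : ∑ i, B (b i) (b i) ≤ 0) {x : V} (hx : x ∈ Submodule.span ℝ (Set.range b)) :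
    B x x = 0 := by
  have hb : ∀ i, b i ∈ Submodule.span ℝ (Set.range b) := fun i => Submodule.subset_span ⟨i, rfl⟩
  have h0 : ∀ i, B (b i) (b i) = 0 := fun i =>
    (Finset.sum_eq_zero_iff_of_nonneg fun i _ => hnn _ (hb i)).1
      (le_antisymm htr (Finset.sum_nonneg fun i _ => hnn _ (hb i))) i (Finset.mem_univ i)
  have h1 : ∀ i, B x (b i) = 0 := by
    intro i
    by_contra hne
    -- Since B(b_i, b_i) = 0, the coefficient is chosen so that B takes the value -1 on the sum.
    have h2 := hnn _ (Submodule.add_mem _ hx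
      (Submodule.smul_mem _ (-(B x x + 1) / (2 * B x (b i))) (hb i)))
    simp only [map_add, map_smul, LinearMap.add_apply, LinearMap.smul_apply, smul_eq_mul, h0,
      hB (b i) x] at h2
    have h3 : -(B x x + 1) / (2 * B x (b i)) * B x (b i) = -(B x x + 1) / 2 := by
      field_simp
    rw [h3] at h2
    linarith
  have h2 : Submodule.span ℝ (Set.range b) ≤ LinearMap.ker (B x) := by
    rw [Submodule.span_le]
    rintro _ ⟨i, rfl⟩
    exact h1 i
  exact h2 hx

/-! ### Symmetric parts of ad, and the Ricci form in a basis adapted to a ⊕ n. -/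

namespace MetricLie

section SymPart

variable {s : Type*} [LieRing s] [LieAlgebra ℝ s] {Q : LinearMap.BilinForm ℝ s} {ι : Type*}

/-- The coefficients of the symmetric part of `ad X` in the family `g`. -/
noncomputable def symPart (Q : LinearMap.BilinForm ℝ s) (g : ι → s) (i j : ι) :
    Module.Dual ℝ s where
  toFun X := (Q ⁅X, g i⁆ (g j) + Q ⁅X, g j⁆ (g i)) / 2
  map_add' X Y := by
    simp only [add_lie, map_add, LinearMap.add_apply]
    ring
  map_smul' c X := by
    simp only [smul_lie, map_smul, LinearMap.smul_apply, smul_eq_mul, RingHom.id_apply]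
    ring

theorem symPart_apply (g : ι → s) (i j : ι) (X : s) :
    symPart Q g i j X = (Q ⁅X, g i⁆ (g j) + Q ⁅X, g j⁆ (g i)) / 2 := rfl

variable [Fintype ι]

/-- The squared norm of the symmetric part of `ad X` in the family `g`. -/
noncomputable def symNorm (Q : LinearMap.BilinForm ℝ s) (g : ι → s) (X : s) : ℝ :=
  ∑ i, ∑ j, (symPart Q g i j X) ^ 2

theorem symNorm_nonneg (g : ι → s) (X : s) : 0 ≤ symNorm Q g X :=
  Finset.sum_nonneg fun _ _ => Finset.sum_nonneg fun _ _ => sq_nonneg _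

theorem symNorm_eq_zero {g : ι → s} {X : s} (h : symNorm Q g X = 0) (i j : ι) :
    symPart Q g i j X = 0 := by
  have h1 := (Finset.sum_eq_zero_iff_of_nonneg fun i _ =>
    Finset.sum_nonneg fun _ _ => sq_nonneg _).1 h i (Finset.mem_univ i)
  have h2 := (Finset.sum_eq_zero_iff_of_nonneg fun _ _ => sq_nonneg _).1 h1 j (Finset.mem_univ j)
  exact pow_eq_zero_iff two_ne_zero |>.1 h2

theorem symNorm_smul_add_smul (g : ι → s) (x y : ℝ) (u v : s) :
    symNorm Q g (x • u + y • v) = x ^ 2 * symNorm Q g u +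
      2 * x * y * (∑ i, ∑ j, symPart Q g i j u * symPart Q g i j v) + y ^ 2 * symNorm Q g v := by
  simp only [symNorm, Finset.mul_sum, ← Finset.sum_add_distrib]
  refine Finset.sum_congr rfl fun i _ => Finset.sum_congr rfl fun j _ => ?_
  rw [map_add, map_smul, map_smul, smul_eq_mul, smul_eq_mul]
  ring

/-- The trace of `ad X` on the span of the family `g`. -/
def traceOn (Q : LinearMap.BilinForm ℝ s) (g : ι → s) (X : s) : ℝ :=
  ∑ i, Q ⁅X, g i⁆ (g i)

theorem traceOn_eq_sum_symPart (g : ι → s) (X : s) :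
    traceOn Q g X = ∑ i, symPart Q g i i X :=
  Finset.sum_congr rfl fun i _ => by rw [symPart_apply, add_self_div_two]

end SymPart

section Adapted

variable {s : Type*} [LieRing s] [LieAlgebra ℝ s] {Q : LinearMap.BilinForm ℝ s}
  {κ ι : Type*} [DecidableEq κ] [DecidableEq ι]
  {e : Module.Basis (κ ⊕ ι) ℝ s}

/-- An orthonormal basis of `s` adapted to the decomposition into `[s, s]` and its complement. -/
structure IsAdapted (Q : LinearMap.BilinForm ℝ s) (e : Module.Basis (κ ⊕ ι) ℝ s) : Prop where
  orthonormal : IsOrthonormalFamily Q e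
  inl_mem : ∀ k, e (Sum.inl k) ∈ complement Q
  inr_mem : ∀ i, e (Sum.inr i) ∈ derived s

theorem lie_mem_derived (x y : s) : ⁅x, y⁆ ∈ derived s :=
  LieSubmodule.lie_mem_lie (LieSubmodule.mem_top _) (LieSubmodule.mem_top _)

theorem apply_eq_zero_of_mem {x A : s} (hx : x ∈ derived s) (hA : A ∈ complement Q) : Q x A = 0 :=
  hA x hx

theorem IsAdapted.lie_inl (he : IsAdapted Q e) (x y : s) (k : κ) :
    Q ⁅x, y⁆ (e (Sum.inl k)) = 0 :=
  apply_eq_zero_of_mem (lie_mem_derived x y) (he.inl_mem k)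

variable [Fintype κ] [Fintype ι]

theorem IsAdapted.sum_mul (he : IsAdapted Q e) {x : s} (hx : x ∈ derived s) (y : s) :
    ∑ i, Q x (e (Sum.inr i)) * Q (e (Sum.inr i)) y = Q x y := by
  rw [← he.orthonormal.sum_mul x y, Fintype.sum_sum_type, right_eq_add]
  exact Finset.sum_eq_zero fun k _ => by rw [apply_eq_zero_of_mem hx (he.inl_mem k), zero_mul]

theorem IsAdapted.sum_smul (he : IsAdapted Q e) {x : s} (hx : x ∈ derived s) :
    ∑ i, Q x (e (Sum.inr i)) • e (Sum.inr i) = x := by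
  conv_rhs => rw [← he.orthonormal.sum_smul x, Fintype.sum_sum_type]
  rw [right_eq_add]
  exact Finset.sum_eq_zero fun k _ => by rw [apply_eq_zero_of_mem hx (he.inl_mem k), zero_smul]

theorem IsAdapted.sum_smul_inl (hQ : IsInnerProduct Q) (he : IsAdapted Q e) {A : s}
    (hA : A ∈ complement Q) : ∑ k, Q A (e (Sum.inl k)) • e (Sum.inl k) = A := by
  conv_rhs => rw [← he.orthonormal.sum_smul A, Fintype.sum_sum_type]
  rw [left_eq_add]
  exact Finset.sum_eq_zero fun i _ => by
    rw [hQ.symm, apply_eq_zero_of_mem (he.inr_mem i) hA, zero_smul]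

theorem IsAdapted.exists_add (he : IsAdapted Q e) (Z : s) :
    ∃ A ∈ complement Q, ∃ Y ∈ derived s, Z = A + Y :=
  ⟨∑ k, Q Z (e (Sum.inl k)) • e (Sum.inl k),
    Submodule.sum_mem _ fun k _ => Submodule.smul_mem _ _ (he.inl_mem k),
    ∑ i, Q Z (e (Sum.inr i)) • e (Sum.inr i),
    Submodule.sum_mem (derived s).toSubmodule fun i _ => Submodule.smul_mem _ _ (he.inr_mem i), by
      rw [← Fintype.sum_sum_type (fun a => Q Z (e a) • e a), he.orthonormal.sum_smul]⟩

theorem IsAdapted.sum_sq (hQ : IsInnerProduct Q) (he : IsAdapted Q e) {x : s}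
    (hx : x ∈ derived s) : ∑ i, (Q x (e (Sum.inr i))) ^ 2 = Q x x := by
  rw [← he.sum_mul hx x]
  exact Finset.sum_congr rfl fun i _ => by rw [hQ.symm (e _) x, pow_two]

section Nilpotent

variable [FiniteDimensional ℝ s] [LieAlgebra.IsSolvable s]

theorem IsAdapted.traceOn_eq_zero (he : IsAdapted Q e) {Y : s} (hY : Y ∈ derived s) :
    traceOn Q (fun i => e (Sum.inr i)) Y = 0 := by
  have h1 : IsNilpotent (LieAlgebra.ad ℝ s Y) :=
    LieModule.isNilpotent_toEnd_of_mem_lie_top_top (M := s) hY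
  have h2 := (LinearMap.isNilpotent_trace_of_isNilpotent h1).eq_zero
  rw [trace_ad he.orthonormal, Fintype.sum_sum_type] at h2
  simpa only [he.lie_inl, Finset.sum_const_zero, zero_add, traceOn] using h2

/-- In general |S(Y)|² = (1/2)(|ad(Y)|_n|² + tr (ad(Y)|_n)²), and the last trace vanishes because
ad(Y) is nilpotent. -/
theorem IsAdapted.symNorm_of_mem_derived (hQ : IsInnerProduct Q) (he : IsAdapted Q e) {Y : s}
    (hY : Y ∈ derived s) : symNorm Q (fun i => e (Sum.inr i)) Y =
      (1 / 2) * ∑ i, Q ⁅Y, e (Sum.inr i)⁆ ⁅Y, e (Sum.inr i)⁆ := by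
  have h1 : IsNilpotent (LieAlgebra.ad ℝ s Y) :=
    LieModule.isNilpotent_toEnd_of_mem_lie_top_top (M := s) hY
  have h2 := (LinearMap.isNilpotent_trace_of_isNilpotent (h1.pow_succ 1)).eq_zero
  rw [he.orthonormal.trace_eq, Fintype.sum_sum_type] at h2
  simp only [pow_succ, pow_zero, one_mul, Module.End.mul_apply, LieAlgebra.ad_apply, he.lie_inl,
    Finset.sum_const_zero, zero_add] at h2
  have h3 : ∀ i, Q ⁅Y, ⁅Y, e (Sum.inr i)⁆⁆ (e (Sum.inr i)) =
      ∑ j, Q ⁅Y, e (Sum.inr i)⁆ (e (Sum.inr j)) * Q ⁅Y, e (Sum.inr j)⁆ (e (Sum.inr i)) := by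
    intro i
    conv_lhs => rw [← he.sum_smul (lie_mem_derived Y (e (Sum.inr i)))]
    rw [lie_sum, map_sum, LinearMap.sum_apply]
    simp only [lie_smul, map_smul, LinearMap.smul_apply, smul_eq_mul]
  simp only [h3] at h2
  have h4 : ∑ i, Q ⁅Y, e (Sum.inr i)⁆ ⁅Y, e (Sum.inr i)⁆ = ∑ i, ∑ j,
      ((Q ⁅Y, e (Sum.inr i)⁆ (e (Sum.inr j))) ^ 2 +
        Q ⁅Y, e (Sum.inr i)⁆ (e (Sum.inr j)) * Q ⁅Y, e (Sum.inr j)⁆ (e (Sum.inr i))) := by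
    simp only [Finset.sum_add_distrib]
    rw [h2, add_zero]
    exact Finset.sum_congr rfl fun i _ => (he.sum_sq hQ (lie_mem_derived _ _)).symm
  rw [h4]
  simp only [symNorm, Finset.mul_sum, symPart_apply]
  refine Finset.sum_sum_eq_of_add_swap_eq fun i j => ?_
  ring

/-- The general formula simplifies because brackets have no component in a and tr ad vanishes on n
by nilpotency. -/
theorem IsAdapted.ricciForm_self (hQ : IsInnerProduct Q) (he : IsAdapted Q e) (X : s) :
    ricciForm hQ X X = -symNorm Q (fun i => e (Sum.inr i)) X
      - (1 / 2) * ∑ k, Q ⁅X, e (Sum.inl k)⁆ ⁅X, e (Sum.inl k)⁆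
      + (1 / 4) * ∑ k, ∑ l, (Q ⁅e (Sum.inl k), e (Sum.inl l)⁆ X) ^ 2
      + (1 / 2) * ∑ k, ∑ i, (Q ⁅e (Sum.inl k), e (Sum.inr i)⁆ X) ^ 2
      + (1 / 4) * ∑ i, ∑ j, (Q ⁅e (Sum.inr i), e (Sum.inr j)⁆ X) ^ 2
      - ∑ k, traceOn Q (fun i => e (Sum.inr i)) (e (Sum.inl k)) * Q ⁅e (Sum.inl k), X⁆ X := by
  have htr : ∀ a, ∑ b, Q ⁅e a, e b⁆ (e b) = traceOn Q (fun i => e (Sum.inr i)) (e a) := by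
    intro a
    rw [Fintype.sum_sum_type]
    simp only [he.lie_inl, Finset.sum_const_zero, zero_add]
    rfl
  have hsymm : ∑ i, ∑ k, (Q ⁅e (Sum.inr i), e (Sum.inl k)⁆ X) ^ 2 =
      ∑ k, ∑ i, (Q ⁅e (Sum.inl k), e (Sum.inr i)⁆ X) ^ 2 := by
    rw [Finset.sum_comm]
    refine Finset.sum_congr rfl fun k _ => Finset.sum_congr rfl fun i _ => ?_
    rw [← lie_skew, map_neg, LinearMap.neg_apply, neg_sq]
  have hS : symNorm Q (fun i => e (Sum.inr i)) X = ∑ i, ∑ j,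
      ((1 / 2) * (Q ⁅X, e (Sum.inr i)⁆ (e (Sum.inr j)) * Q ⁅X, e (Sum.inr i)⁆ (e (Sum.inr j))) +
      (1 / 2) * (Q ⁅X, e (Sum.inr i)⁆ (e (Sum.inr j)) * Q ⁅X, e (Sum.inr j)⁆ (e (Sum.inr i)))) := by
    simp only [symNorm, symPart_apply]
    refine Finset.sum_sum_eq_of_add_swap_eq fun i j => ?_
    ring
  rw [ricciForm_eq_sum hQ he.orthonormal]
  simp only [htr, Fintype.sum_sum_type, he.lie_inl, he.traceOn_eq_zero (he.inr_mem _), zero_mul,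
    mul_zero, Finset.sum_const_zero, add_zero, sub_zero]
  rw [hS]
  simp only [← he.sum_sq hQ (lie_mem_derived X _), Finset.sum_add_distrib, Finset.sum_sub_distrib,
    ← Finset.mul_sum, ← pow_two, hsymm]
  have h5 : ∀ k, (1 / 2 : ℝ) * (Q ⁅e (Sum.inl k), X⁆ X + Q ⁅e (Sum.inl k), X⁆ X) =
      Q ⁅e (Sum.inl k), X⁆ X := fun k => by ring
  simp only [h5]
  ring

end Nilpotent

end Adapted

end MetricLie

/-! ### Consequences of the failure of case (3). -/

namespace MetricLie

section Alternatives

variable {s : Type*} [LieRing s] [LieAlgebra ℝ s] {Q : LinearMap.BilinForm ℝ s}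
  {κ ι : Type*} [Fintype κ] [Fintype ι] {e : Module.Basis (κ ⊕ ι) ℝ s}

/-- The difference between the Ricci form and minus the squared norm of the symmetric part of
`ad`, as a function of the component in `[s, s]`. -/
noncomputable def ricciDefect (Q : LinearMap.BilinForm ℝ s) (e : Module.Basis (κ ⊕ ι) ℝ s)
    (Y : s) : ℝ :=
  (1 / 4) * ∑ i, ∑ j, (Q ⁅e (Sum.inr i), e (Sum.inr j)⁆ Y) ^ 2
    + (1 / 2) * ∑ k, (∑ i, (Q ⁅e (Sum.inl k), e (Sum.inr i)⁆ Y) ^ 2 -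
        Q ⁅e (Sum.inl k), Y⁆ ⁅e (Sum.inl k), Y⁆)
    - ∑ k, traceOn Q (fun i => e (Sum.inr i)) (e (Sum.inl k)) * Q ⁅e (Sum.inl k), Y⁆ Y

theorem ricciDefect_smul (c : ℝ) (Y : s) :
    ricciDefect Q e (c • Y) = c ^ 2 * ricciDefect Q e Y := by
  simp only [ricciDefect, mul_sub, mul_add, Finset.mul_sum, map_smul, lie_smul,
    LinearMap.smul_apply, smul_eq_mul, mul_pow]
  congr 1
  · congr 1
    · exact Finset.sum_congr rfl fun i _ => Finset.sum_congr rfl fun j _ => by ring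
    · refine Finset.sum_congr rfl fun k _ => ?_
      congr 1
      · exact Finset.sum_congr rfl fun j _ => by ring
      · ring
  · exact Finset.sum_congr rfl fun i _ => by ring

variable [FiniteDimensional ℝ s]

theorem exists_ricciForm_nonneg (hQ : IsInnerProduct Q) (h3 : ¬CaseThree hQ) (u v : s) :
    ∃ x y : ℝ, (x ≠ 0 ∨ y ≠ 0) ∧ 0 ≤ ricciForm hQ (x • u + y • v) (x • u + y • v) := by
  by_contra hcon
  push Not at hcon
  exact h3 (caseThree_of_neg hQ u v hcon)

variable [LieAlgebra.IsSolvable s] [DecidableEq κ] [DecidableEq ι]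

theorem IsAdapted.ricciForm_of_mem_complement (hQ : IsInnerProduct Q) (he : IsAdapted Q e)
    {A : s} (hA : A ∈ complement Q) :
    ricciForm hQ A A = -symNorm Q (fun i => e (Sum.inr i)) A
      - (1 / 2) * ∑ k, Q ⁅A, e (Sum.inl k)⁆ ⁅A, e (Sum.inl k)⁆ := by
  have h0 : ∀ x y, Q ⁅x, y⁆ A = 0 := fun x y => apply_eq_zero_of_mem (lie_mem_derived x y) hA
  rw [he.ricciForm_self hQ]
  simp [h0]

/-- On a the Ricci form is minus a sum of squares, so a combination with Ric ≥ 0 makes every square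
vanish. -/
theorem IsAdapted.exists_smul_add_smul (hQ : IsInnerProduct Q) (he : IsAdapted Q e)
    (h3 : ¬CaseThree hQ) {A B : s} (hA : A ∈ complement Q) (hB : B ∈ complement Q) :
    ∃ x y : ℝ, (x ≠ 0 ∨ y ≠ 0) ∧ (∀ C ∈ complement Q, ⁅x • A + y • B, C⁆ = 0) ∧
      ∀ i j, symPart Q (fun i => e (Sum.inr i)) i j (x • A + y • B) = 0 := by
  obtain ⟨x, y, hxy, hr⟩ := exists_ricciForm_nonneg hQ h3 A B
  have hZ : x • A + y • B ∈ complement Q :=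
    Submodule.add_mem _ (Submodule.smul_mem _ _ hA) (Submodule.smul_mem _ _ hB)
  rw [he.ricciForm_of_mem_complement hQ hZ] at hr
  have h1 := symNorm_nonneg (Q := Q) (fun i => e (Sum.inr i)) (x • A + y • B)
  have h2 : ∀ k ∈ Finset.univ,
      0 ≤ Q ⁅x • A + y • B, e (Sum.inl k)⁆ ⁅x • A + y • B, e (Sum.inl k)⁆ :=
    fun k _ => hQ.nonneg _
  have h4 := Finset.sum_nonneg h2
  refine ⟨x, y, hxy, fun C hC => ?_, symNorm_eq_zero (by linarith)⟩
  have h5 := (Finset.sum_eq_zero_iff_of_nonneg h2).1 (by linarith)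
  rw [← he.sum_smul_inl hQ hC, lie_sum]
  exact Finset.sum_eq_zero fun k hk => by rw [lie_smul, hQ.eq_zero (h5 k hk), smul_zero]

theorem IsAdapted.complement_commutative (hQ : IsInnerProduct Q) (he : IsAdapted Q e)
    (h3 : ¬CaseThree hQ) {A B : s} (hA : A ∈ complement Q) (hB : B ∈ complement Q) :
    ⁅A, B⁆ = 0 := by
  obtain ⟨x, y, hxy, hc, -⟩ := he.exists_smul_add_smul hQ h3 hA hB
  rcases hxy with hx | hy
  · have := hc B hB
    rw [add_lie, smul_lie, smul_lie, lie_self, smul_zero, add_zero] at this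
    exact (smul_eq_zero.1 this).resolve_left hx
  · have := hc A hA
    rw [add_lie, smul_lie, smul_lie, lie_self, smul_zero, zero_add] at this
    rw [← lie_skew, (smul_eq_zero.1 this).resolve_left hy, neg_zero]

theorem IsAdapted.exists_symPart_eq_mul (hQ : IsInnerProduct Q) (he : IsAdapted Q e)
    (h3 : ¬CaseThree hQ) {X : s} (hX : X ∈ complement Q)
    (hX0 : symNorm Q (fun i => e (Sum.inr i)) X ≠ 0) {A : s} (hA : A ∈ complement Q) :
    ∃ β : ℝ, ∀ i j, symPart Q (fun i => e (Sum.inr i)) i j (A - β • X) = 0 := by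
  obtain ⟨x, y, hxy, -, hs⟩ := he.exists_smul_add_smul hQ h3 hX hA
  have hy : y ≠ 0 := by
    rintro rfl
    refine hX0 (Finset.sum_eq_zero fun i _ => Finset.sum_eq_zero fun j _ => ?_)
    have := hs i j
    rw [zero_smul, add_zero, map_smul, smul_eq_mul] at this
    rw [(mul_eq_zero.1 this).resolve_left (by simpa using hxy)]
    simp
  refine ⟨-(x / y), fun i j => ?_⟩
  have h1 : A - -(x / y) • X = y⁻¹ • (x • X + y • A) := by
    rw [smul_add, smul_smul, smul_smul, inv_mul_cancel₀ hy, one_smul, neg_smul, sub_neg_eq_add,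
      add_comm, div_eq_inv_mul]
  rw [h1, map_smul, hs, smul_zero]

/-- Brackets are orthogonal to A, and [A, a] = 0; hence A enters only through the symmetric part. -/
theorem IsAdapted.ricciForm_add (hQ : IsInnerProduct Q) (he : IsAdapted Q e)
    (hc : ∀ A ∈ complement Q, ∀ B ∈ complement Q, ⁅A, B⁆ = 0) {A Y : s}
    (hA : A ∈ complement Q) : ricciForm hQ (A + Y) (A + Y) =
      -symNorm Q (fun i => e (Sum.inr i)) (A + Y) + ricciDefect Q e Y := by
  have h0 : ∀ x y, Q ⁅x, y⁆ A = 0 := fun x y => apply_eq_zero_of_mem (lie_mem_derived x y) hA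
  have h1 : ∀ k, Q ⁅A + Y, e (Sum.inl k)⁆ ⁅A + Y, e (Sum.inl k)⁆ =
      Q ⁅e (Sum.inl k), Y⁆ ⁅e (Sum.inl k), Y⁆ := by
    intro k
    rw [add_lie, hc A hA _ (he.inl_mem k), zero_add, ← lie_skew (e (Sum.inl k)) Y]
    simp only [map_neg, LinearMap.neg_apply, neg_neg]
  have h2 : ∀ k, ⁅e (Sum.inl k), A + Y⁆ = ⁅e (Sum.inl k), Y⁆ := fun k => by
    rw [lie_add, hc _ (he.inl_mem k) A hA, zero_add]
  rw [he.ricciForm_self hQ]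
  simp only [h1, h2, map_add (Q _), h0, zero_add, ricciDefect,
    hc _ (he.inl_mem _) _ (he.inl_mem _), map_zero, LinearMap.zero_apply, Finset.sum_sub_distrib]
  simp
  ring

/-- This is a discriminant condition: the binary quadratic form (x, y) ↦ Ric(xX + yY, xX + yY) has
negative x²-coefficient, yet is nonnegative at some nonzero point. -/
theorem IsAdapted.mul_symNorm_sub_le (hQ : IsInnerProduct Q) (he : IsAdapted Q e)
    (h3 : ¬CaseThree hQ) {X : s} (hX : X ∈ complement Q)
    (hX0 : symNorm Q (fun i => e (Sum.inr i)) X ≠ 0) (Y : s) :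
    symNorm Q (fun i => e (Sum.inr i)) X *
        (symNorm Q (fun i => e (Sum.inr i)) Y - ricciDefect Q e Y) ≤
      (∑ i, ∑ j, symPart Q (fun i => e (Sum.inr i)) i j X *
        symPart Q (fun i => e (Sum.inr i)) i j Y) ^ 2 := by
  obtain ⟨x, y, hxy, hr⟩ := exists_ricciForm_nonneg hQ h3 X Y
  have hN := (symNorm_nonneg (Q := Q) (fun i => e (Sum.inr i)) X).lt_of_ne' hX0
  rw [he.ricciForm_add hQ (fun A hA B hB => he.complement_commutative hQ h3 hA hB)
    (Submodule.smul_mem _ _ hX), symNorm_smul_add_smul, ricciDefect_smul] at hr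
  set N := symNorm Q (fun i => e (Sum.inr i)) X
  set F := symNorm Q (fun i => e (Sum.inr i)) Y
  set q := ricciDefect Q e Y
  set P := ∑ i, ∑ j, symPart Q (fun i => e (Sum.inr i)) i j X *
        symPart Q (fun i => e (Sum.inr i)) i j Y
  have hy : y ≠ 0 := by
    rintro rfl
    have hx : 0 < x ^ 2 := by
      have : x ≠ 0 := by simpa using hxy
      positivity
    nlinarith [mul_pos hx hN]
  have hy2 : 0 < y ^ 2 := by positivity
  by_contra hlt
  push Not at hlt
  have h4 := mul_pos hy2 (sub_pos.2 hlt)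
  have h5 := mul_nonneg hN.le hr
  -- Completing the square: N Ric = -(xN + yP)² + y²(P² - N(F - q)).
  nlinarith [sq_nonneg (x * N + y * P)]

theorem IsAdapted.ricciDefect_nonneg (hQ : IsInnerProduct Q) (he : IsAdapted Q e)
    (h3 : ¬CaseThree hQ) {X : s} (hX : X ∈ complement Q)
    (hX0 : symNorm Q (fun i => e (Sum.inr i)) X ≠ 0) (Y : s) : 0 ≤ ricciDefect Q e Y := by
  obtain ⟨x, y, hxy, hr⟩ := exists_ricciForm_nonneg hQ h3 X Y
  have hN := (symNorm_nonneg (Q := Q) (fun i => e (Sum.inr i)) X).lt_of_ne' hX0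
  rw [he.ricciForm_add hQ (fun A hA B hB => he.complement_commutative hQ h3 hA hB)
    (Submodule.smul_mem _ _ hX), ricciDefect_smul] at hr
  have h1 := symNorm_nonneg (Q := Q) (fun i => e (Sum.inr i)) (x • X + y • Y)
  by_cases hy : y = 0
  · subst hy
    have hx : 0 < x ^ 2 := by
      have : x ≠ 0 := by simpa using hxy
      positivity
    rw [symNorm_smul_add_smul] at hr
    nlinarith [mul_pos hx hN]
  · have hy2 : 0 < y ^ 2 := by positivity
    exact nonneg_of_mul_nonneg_right (by linarith : 0 ≤ y ^ 2 * ricciDefect Q e Y) hy2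

/-- Let P_l = ⟨S(X), S(e_l)⟩ and w = ∑ P_l e_l, so |P|² = ⟨S(X), S(w)⟩. Cauchy–Schwarz bounds |P|⁴
by |S(X)|² |S(w)|². Here |S(w)|² = (1/2) ∑ |[w, e_j]|², and `two_mul_sum_sq_le_of_skew`, applied to
each component of the bracket of n, supplies a second factor 1/2. -/
theorem IsAdapted.sum_sq_symPart_le (hQ : IsInnerProduct Q) (he : IsAdapted Q e) (X : s) :
    ∑ l, (∑ i, ∑ j, symPart Q (fun i => e (Sum.inr i)) i j X *
        symPart Q (fun i => e (Sum.inr i)) i j (e (Sum.inr l))) ^ 2 ≤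
      symNorm Q (fun i => e (Sum.inr i)) X *
        ((1 / 4) * ∑ l, ∑ i, ∑ j, (Q ⁅e (Sum.inr i), e (Sum.inr j)⁆ (e (Sum.inr l))) ^ 2) := by
  set S : ι → ι → Module.Dual ℝ s := symPart Q (fun i => e (Sum.inr i)) with hS
  set P : ι → ℝ := fun l => ∑ i, ∑ j, S i j X * S i j (e (Sum.inr l)) with hP
  set N := symNorm Q (fun i => e (Sum.inr i)) X with hN
  set w : s := ∑ l, P l • e (Sum.inr l) with hw
  have hwmem : w ∈ derived s := Submodule.sum_mem (derived s).toSubmodule fun l _ =>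
    Submodule.smul_mem _ _ (he.inr_mem l)
  have h1 : ∑ i, ∑ j, S i j X * S i j w = ∑ l, P l ^ 2 := by
    have : ∀ i j, S i j X * S i j w = ∑ l, P l * (S i j X * S i j (e (Sum.inr l))) := by
      intro i j
      rw [hw, map_sum, Finset.mul_sum]
      exact Finset.sum_congr rfl fun l _ => by rw [map_smul, smul_eq_mul]; ring
    simp only [this]
    rw [Finset.sum_congr rfl fun i _ => Finset.sum_comm, Finset.sum_comm]
    refine Finset.sum_congr rfl fun l _ => ?_
    simp only [← Finset.mul_sum]
    rw [pow_two]
  have h2 : (∑ i, ∑ j, S i j X * S i j w) ^ 2 ≤ N * symNorm Q (fun i => e (Sum.inr i)) w := by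
    rw [hN, symNorm, symNorm]
    simp only [← Fintype.sum_prod_type']
    exact Finset.sum_mul_sq_le_sq_mul_sq _ _ _
  have h3 : symNorm Q (fun i => e (Sum.inr i)) w ≤ (1 / 4) * (∑ l, ∑ i, ∑ j,
      (Q ⁅e (Sum.inr i), e (Sum.inr j)⁆ (e (Sum.inr l))) ^ 2) * ∑ l, P l ^ 2 := by
    rw [he.symNorm_of_mem_derived hQ hwmem]
    have h4 : ∀ j, Q ⁅w, e (Sum.inr j)⁆ ⁅w, e (Sum.inr j)⁆ =
        ∑ l, (∑ i, P i * Q ⁅e (Sum.inr i), e (Sum.inr j)⁆ (e (Sum.inr l))) ^ 2 := by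
      intro j
      rw [← he.sum_sq hQ (lie_mem_derived _ _)]
      refine Finset.sum_congr rfl fun l _ => ?_
      rw [hw, sum_lie, map_sum, LinearMap.sum_apply]
      simp only [smul_lie, map_smul, LinearMap.smul_apply, smul_eq_mul]
    simp only [h4]
    rw [Finset.sum_comm, mul_assoc, Finset.sum_mul, Finset.mul_sum, Finset.mul_sum]
    refine Finset.sum_le_sum fun l _ => ?_
    have h5 := two_mul_sum_sq_le_of_skew
      (fun i j => Q ⁅e (Sum.inr i), e (Sum.inr j)⁆ (e (Sum.inr l)))
      (fun i j => by rw [← lie_skew, map_neg, LinearMap.neg_apply]) P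
    linarith
  have hp : 0 ≤ ∑ l, P l ^ 2 := Finset.sum_nonneg fun _ _ => sq_nonneg _
  have hN0 : 0 ≤ N := symNorm_nonneg _ _
  have hm : 0 ≤ ∑ l, ∑ i, ∑ j, (Q ⁅e (Sum.inr i), e (Sum.inr j)⁆ (e (Sum.inr l))) ^ 2 :=
    Finset.sum_nonneg fun _ _ => Finset.sum_nonneg fun _ _ => Finset.sum_nonneg fun _ _ =>
      sq_nonneg _
  rw [h1] at h2
  change ∑ l, P l ^ 2 ≤ _
  clear_value P N
  rcases hp.eq_or_lt with h0 | hpos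
  · rw [← h0]
    exact mul_nonneg hN0 (mul_nonneg (by norm_num) hm)
  · refine le_of_mul_le_mul_right ?_ hpos
    rw [← pow_two, mul_assoc]
    exact h2.trans (mul_le_mul_of_nonneg_left h3 hN0)

/-- Let c be the sum of squared structure constants of n. Summing `IsAdapted.mul_symNorm_sub_le`
over the basis of n gives c/2 - (c/4 - ∑ tr²) ≤ c/4. The c-terms cancel exactly, leaving ∑ tr² ≤ 0.
-/
theorem IsAdapted.traceOn_eq_zero_of_not_caseThree (hQ : IsInnerProduct Q) (he : IsAdapted Q e)
    (h3 : ¬CaseThree hQ) {X : s} (hX : X ∈ complement Q)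
    (hX0 : symNorm Q (fun i => e (Sum.inr i)) X ≠ 0) (k : κ) :
    traceOn Q (fun i => e (Sum.inr i)) (e (Sum.inl k)) = 0 := by
  have hN := (symNorm_nonneg (Q := Q) (fun i => e (Sum.inr i)) X).lt_of_ne' hX0
  have h1 := Finset.sum_le_sum fun l (_ : l ∈ Finset.univ) =>
    he.mul_symNorm_sub_le hQ h3 hX hX0 (e (Sum.inr l))
  rw [← Finset.mul_sum, Finset.sum_sub_distrib] at h1
  have h2 := le_of_mul_le_mul_left (h1.trans (he.sum_sq_symPart_le hQ X)) hN
  have h4 : ∑ l, symNorm Q (fun i => e (Sum.inr i)) (e (Sum.inr l)) = (1 / 2) * ∑ l, ∑ i, ∑ j,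
      (Q ⁅e (Sum.inr i), e (Sum.inr j)⁆ (e (Sum.inr l))) ^ 2 := by
    simp only [he.symNorm_of_mem_derived hQ (he.inr_mem _), ← Finset.mul_sum,
      ← he.sum_sq hQ (lie_mem_derived _ _)]
    congr 1
    rw [Finset.sum_congr rfl fun i _ => Finset.sum_comm, Finset.sum_comm]
  have h5 : ∑ l, ricciDefect Q e (e (Sum.inr l)) = (1 / 4) * (∑ l, ∑ i, ∑ j,
      (Q ⁅e (Sum.inr i), e (Sum.inr j)⁆ (e (Sum.inr l))) ^ 2) -
      ∑ k, traceOn Q (fun i => e (Sum.inr i)) (e (Sum.inl k)) ^ 2 := by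
    simp only [ricciDefect, Finset.sum_sub_distrib, Finset.sum_add_distrib, ← Finset.mul_sum,
      ← he.sum_sq hQ (lie_mem_derived _ _)]
    -- Each ad(a_k)|_n and its adjoint have the same Frobenius norm, so the middle term of
    -- `ricciDefect` is traceless on n.
    have h6 : ∑ l, ∑ k, ∑ i, (Q ⁅e (Sum.inl k), e (Sum.inr i)⁆ (e (Sum.inr l))) ^ 2 =
        ∑ l, ∑ k, ∑ i, (Q ⁅e (Sum.inl k), e (Sum.inr l)⁆ (e (Sum.inr i))) ^ 2 := by
      rw [Finset.sum_comm, Finset.sum_comm (s := Finset.univ (α := ι)) (t := Finset.univ (α := κ))]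
      exact Finset.sum_congr rfl fun k _ => Finset.sum_comm
    have h7 : ∑ l, ∑ k, traceOn Q (fun i => e (Sum.inr i)) (e (Sum.inl k)) *
        Q ⁅e (Sum.inl k), e (Sum.inr l)⁆ (e (Sum.inr l)) =
        ∑ k, traceOn Q (fun i => e (Sum.inr i)) (e (Sum.inl k)) ^ 2 := by
      rw [Finset.sum_comm]
      refine Finset.sum_congr rfl fun k _ => ?_
      rw [← Finset.mul_sum, pow_two]
      rfl
    rw [h6, h7]
    ring
  rw [h4, h5] at h2
  have h6 : ∑ k, traceOn Q (fun i => e (Sum.inr i)) (e (Sum.inl k)) ^ 2 ≤ 0 := by linarith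
  have h7 := (Finset.sum_eq_zero_iff_of_nonneg fun k _ => sq_nonneg _).1
    (le_antisymm h6 (Finset.sum_nonneg fun _ _ => sq_nonneg _)) k (Finset.mem_univ k)
  exact pow_eq_zero_iff two_ne_zero |>.1 h7

end Alternatives

end MetricLie

/-! ### The flag s ⊃ n ⊃ [n, n], and commutativity of n. -/

namespace MetricLie

section Skew

variable {s : Type*} [LieRing s] [LieAlgebra ℝ s] {Q : LinearMap.BilinForm ℝ s}
  {κ ι : Type*} [Fintype κ] [Fintype ι] [DecidableEq κ] [DecidableEq ι]
  {e : Module.Basis (κ ⊕ ι) ℝ s}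

theorem IsAdapted.lie_skew_of_symPart_eq_zero (hQ : IsInnerProduct Q) (he : IsAdapted Q e) {A : s}
    (hA : ∀ i j, symPart Q (fun i => e (Sum.inr i)) i j A = 0) {Y Z : s} (hY : Y ∈ derived s)
    (hZ : Z ∈ derived s) : Q ⁅A, Y⁆ Z = -Q Y ⁅A, Z⁆ := by
  have h1 : ∀ i j, Q ⁅A, e (Sum.inr i)⁆ (e (Sum.inr j)) =
      -Q (e (Sum.inr i)) ⁅A, e (Sum.inr j)⁆ := by
    intro i j
    have := hA i j
    rw [symPart_apply] at this
    rw [hQ.symm (e (Sum.inr i))]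
    linarith
  rw [← he.sum_smul hY, ← he.sum_smul hZ]
  simp only [lie_sum, lie_smul, map_sum, LinearMap.sum_apply, map_smul, LinearMap.smul_apply, h1,
    smul_neg, Finset.sum_neg_distrib]

/-- A skew operator and its adjoint have the same norm on each vector, and its trace is zero; only
the bracket of n contributes. -/
theorem IsAdapted.ricciDefect_of_skew (hQ : IsInnerProduct Q) (he : IsAdapted Q e)
    (hS : ∀ k i j, symPart Q (fun i => e (Sum.inr i)) i j (e (Sum.inl k)) = 0) {Y : s}
    (hY : Y ∈ derived s) : ricciDefect Q e Y =
      (1 / 4) * ∑ i, ∑ j, (Q ⁅e (Sum.inr i), e (Sum.inr j)⁆ Y) ^ 2 := by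
  have h1 : ∀ k i, Q ⁅e (Sum.inl k), e (Sum.inr i)⁆ Y = -Q ⁅e (Sum.inl k), Y⁆ (e (Sum.inr i)) := by
    intro k i
    rw [he.lie_skew_of_symPart_eq_zero hQ (hS k) (he.inr_mem i) hY, hQ.symm]
  simp only [ricciDefect, traceOn_eq_sum_symPart, hS, h1, neg_sq,
    he.sum_sq hQ (lie_mem_derived _ _), sub_self]
  simp

end Skew

section Flag

variable {s : Type*} [LieRing s] [LieAlgebra ℝ s] {Q : LinearMap.BilinForm ℝ s}
  {κ π ρ : Type*} {e : Module.Basis (κ ⊕ (π ⊕ ρ)) ℝ s}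

/-- The span of the part of an adapted basis complementary to the derived algebra of `[s, s]`. -/
def generators (e : Module.Basis (κ ⊕ (π ⊕ ρ)) ℝ s) : Submodule ℝ s :=
  Submodule.span ℝ (Set.range fun i => e (Sum.inr (Sum.inl i)))

theorem apply_generators_eq_zero {x Y : s}
    (hx : ∀ i, Q x (e (Sum.inr (Sum.inl i))) = 0) (hY : Y ∈ generators e) : Q x Y = 0 := by
  have h1 : generators e ≤ LinearMap.ker (Q x) := by
    rw [generators, Submodule.span_le]
    rintro _ ⟨i, rfl⟩
    exact hx i
  exact h1 hY

variable [DecidableEq κ] [DecidableEq π] [DecidableEq ρ]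

/-- An orthonormal basis of `s` adapted to the flag formed by `[s, s]` and its derived algebra. -/
structure IsFlagAdapted (Q : LinearMap.BilinForm ℝ s) (e : Module.Basis (κ ⊕ (π ⊕ ρ)) ℝ s) : Prop
    extends IsAdapted Q e where
  perp : ∀ y ∈ derived s, ∀ z ∈ derived s, ∀ i, Q ⁅y, z⁆ (e (Sum.inr (Sum.inl i))) = 0
  exists_mem : ∀ j, ∃ y ∈ (⁅(⊤ : LieIdeal ℝ (derived s)), (⊤ : LieIdeal ℝ (derived s))⁆),
    (y : s) = e (Sum.inr (Sum.inr j))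

theorem exists_isFlagAdapted [FiniteDimensional ℝ s] (hQ : IsInnerProduct Q) :
    ∃ (m p r : ℕ) (e : Module.Basis (Fin m ⊕ (Fin p ⊕ Fin r)) ℝ s), IsFlagAdapted Q e := by
  set N := (derived s).toSubmodule
  have hR : IsInnerProduct (Q.restrict N) := hQ.restrict N
  set D : LieIdeal ℝ (derived s) := ⁅(⊤ : LieIdeal ℝ (derived s)), (⊤ : LieIdeal ℝ (derived s))⁆
    with hD
  obtain ⟨b, hb⟩ := (hR.restrict D.toSubmodule).exists_orthonormal_basis
  obtain ⟨p, c, hc, hcD, hcb⟩ := hR.exists_adapted_basis D.toSubmodule b hb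
  obtain ⟨m, e, he, heN, hec⟩ := hQ.exists_adapted_basis N c hc
  refine ⟨m, p, _, e, ⟨⟨he, fun k w hw => heN k w hw, fun i => ?_⟩, fun y hy z hz i => ?_,
    fun j => ⟨b j, (b j).2, ?_⟩⟩⟩
  · rw [hec]
    exact (c i).2
  · have h1 : ⁅(⟨y, hy⟩ : derived s), (⟨z, hz⟩ : derived s)⁆ ∈ D :=
      LieSubmodule.lie_mem_lie (LieSubmodule.mem_top _) (LieSubmodule.mem_top _)
    rw [hec]
    exact hcD i _ h1
  · rw [hec, hcb]

/-- By the Jacobi identity, ad(s) preserves [n, n]. -/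
theorem IsFlagAdapted.lie_inr_inr (he : IsFlagAdapted Q e) (x : s) (i : π) (j : ρ) :
    Q ⁅x, e (Sum.inr (Sum.inr j))⁆ (e (Sum.inr (Sum.inl i))) = 0 := by
  obtain ⟨y, hy, hyj⟩ := he.exists_mem j
  rw [← hyj]
  clear hyj
  rw [← LieSubmodule.mem_toSubmodule, LieSubmodule.lieIdeal_oper_eq_linear_span'] at hy
  induction hy using Submodule.span_induction with
  | mem y hy =>
    obtain ⟨a, -, b, -, rfl⟩ := hy
    change Q ⁅x, ⁅(a : s), (b : s)⁆⁆ _ = 0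
    rw [leibniz_lie, map_add, LinearMap.add_apply, he.perp _ (lie_mem_derived _ _) _ b.2,
      he.perp _ a.2 _ (lie_mem_derived _ _), add_zero]
  | zero => simp
  | add y z _ _ h1 h2 =>
    rw [LieSubmodule.coe_add, lie_add, map_add, LinearMap.add_apply, h1, h2, add_zero]
  | smul c y _ h => rw [LieSubmodule.coe_smul, lie_smul, map_smul, LinearMap.smul_apply, h,
      smul_zero]

theorem IsFlagAdapted.generators_le (he : IsFlagAdapted Q e) :
    generators e ≤ (derived s).toSubmodule := by
  rw [generators, Submodule.span_le]
  rintro _ ⟨i, rfl⟩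
  exact he.inr_mem _

variable [Fintype κ] [Fintype π] [Fintype ρ]

/-- On the generators twice the defect is a quadratic form comparing the adjoint of ad(a_k),
compressed to the generators, with ad(a_k) into all of n. Its trace is nonpositive, so nonnegativity
forces it to vanish. -/
theorem IsFlagAdapted.ricciDefect_eq_zero (hQ : IsInnerProduct Q) (he : IsFlagAdapted Q e)
    (htr : ∀ k, traceOn Q (fun i => e (Sum.inr i)) (e (Sum.inl k)) = 0)
    (hnn : ∀ Y ∈ derived s, 0 ≤ ricciDefect Q e Y) {Y : s} (hY : Y ∈ generators e) :
    ricciDefect Q e Y = 0 := by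
  let φ : κ → π → Module.Dual ℝ s := fun k i => Q ⁅e (Sum.inl k), e (Sum.inr (Sum.inl i))⁆
  let B : LinearMap.BilinForm ℝ s := ∑ k, (∑ i, LinearMap.BilinForm.linMulLin (φ k i) (φ k i) -
    Q.comp (LieAlgebra.ad ℝ s (e (Sum.inl k))) (LieAlgebra.ad ℝ s (e (Sum.inl k))))
  have hB : ∀ X Y, B X Y = ∑ k, (∑ i, φ k i X * φ k i Y -
      Q ⁅e (Sum.inl k), X⁆ ⁅e (Sum.inl k), Y⁆) := by
    intro X Y
    simp [B, LinearMap.sum_apply]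
  have hBY : ∀ Y ∈ generators e, ricciDefect Q e Y = (1 / 2) * B Y Y := by
    intro Y hY
    have h1 : ∀ i j, Q ⁅e (Sum.inr i), e (Sum.inr j)⁆ Y = 0 := fun i j =>
      apply_generators_eq_zero (he.perp _ (he.inr_mem i) _ (he.inr_mem j)) hY
    have h2 : ∀ k j, Q ⁅e (Sum.inl k), e (Sum.inr (Sum.inr j))⁆ Y = 0 := fun k j =>
      apply_generators_eq_zero (fun i => he.lie_inr_inr _ i j) hY
    rw [ricciDefect, hB]
    simp only [h1, h2, htr, Fintype.sum_sum_type, φ]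
    simp [pow_two]
  rw [hBY Y hY, LinearMap.BilinForm.apply_self_eq_zero_of_trace_nonpos B ?_
    (fun i => e (Sum.inr (Sum.inl i))) ?_ ?_ hY, mul_zero]
  · intro X Y
    rw [hB, hB]
    refine Finset.sum_congr rfl fun k _ => ?_
    rw [hQ.symm ⁅_, X⁆]
    congr 1
    exact Finset.sum_congr rfl fun i _ => mul_comm _ _
  · intro X hX
    have := hnn X (he.generators_le hX)
    rw [hBY X hX] at this
    linarith
  -- After exchanging the two generator indices, each k contributes minus the squared norm of the
  -- components of [a_k, generators] in [n, n].
  · simp only [hB]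
    rw [Finset.sum_comm]
    refine Finset.sum_nonpos fun k _ => ?_
    rw [Finset.sum_sub_distrib, Finset.sum_comm, ← Finset.sum_sub_distrib]
    refine Finset.sum_nonpos fun i _ => ?_
    rw [← he.sum_sq hQ (lie_mem_derived _ _), Fintype.sum_sum_type, sub_nonpos]
    simp only [φ, ← pow_two]
    exact le_add_of_nonneg_right (Finset.sum_nonneg fun _ _ => sq_nonneg _)

/-- With no defect, Ric(Y, Y) = -(1/2) ∑ |[Y, e_i]|² on generators, so of any two generators some
nontrivial combination centralizes n; hence they commute. -/
theorem IsFlagAdapted.isLieAbelian_derived [FiniteDimensional ℝ s] [LieAlgebra.IsSolvable s]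
    (hQ : IsInnerProduct Q) (he : IsFlagAdapted Q e) (h3 : ¬CaseThree hQ)
    (h0 : ∀ Y ∈ generators e, ricciDefect Q e Y = 0) : IsLieAbelian (derived s) := by
  have hcomm : ∀ A ∈ generators e, ∀ B ∈ generators e, ⁅A, B⁆ = 0 := by
    intro A hA B hB
    obtain ⟨x, y, hxy, hr⟩ := exists_ricciForm_nonneg hQ h3 A B
    have hZ : x • A + y • B ∈ generators e :=
      Submodule.add_mem _ (Submodule.smul_mem _ _ hA) (Submodule.smul_mem _ _ hB)
    have h1 := he.ricciForm_add hQ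
      (fun A hA B hB => he.complement_commutative hQ h3 hA hB) (A := 0) (Y := x • A + y • B)
      (Submodule.zero_mem _)
    rw [zero_add, h0 _ hZ, add_zero] at h1
    rw [h1, he.symNorm_of_mem_derived hQ (he.generators_le hZ)] at hr
    have h2 : ∀ i ∈ Finset.univ, 0 ≤ Q ⁅x • A + y • B, e (Sum.inr i)⁆
        ⁅x • A + y • B, e (Sum.inr i)⁆ := fun i _ => hQ.nonneg _
    have h4 := (Finset.sum_eq_zero_iff_of_nonneg h2).1
      (le_antisymm (by linarith) (Finset.sum_nonneg h2))
    have h5 : ∀ C ∈ generators e, ⁅x • A + y • B, C⁆ = 0 := by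
      intro C hC
      rw [← he.sum_smul (he.generators_le hC), lie_sum]
      exact Finset.sum_eq_zero fun i hi => by rw [lie_smul, hQ.eq_zero (h4 i hi), smul_zero]
    rcases hxy with hx | hy
    · have := h5 B hB
      rw [add_lie, smul_lie, smul_lie, lie_self, smul_zero, add_zero] at this
      exact (smul_eq_zero.1 this).resolve_left hx
    · have := h5 A hA
      rw [add_lie, smul_lie, smul_lie, lie_self, smul_zero, zero_add] at this
      rw [← lie_skew, (smul_eq_zero.1 this).resolve_left hy, neg_zero]
  have hnil : LieRing.IsNilpotent (derived s) := LieAlgebra.isNilpotent_lie_top_top (K := ℝ)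
  refine LieAlgebra.isLieAbelian_of_isNilpotent_of_commuting_generators (K := ℝ)
    {y : derived s | (y : s) ∈ generators e} (fun x => ?_)
    (fun a ha b hb => Subtype.ext (hcomm a ha b hb))
  have hmem : ∑ i, Q x (e (Sum.inr (Sum.inl i))) • e (Sum.inr (Sum.inl i)) ∈ generators e :=
    Submodule.sum_mem _ fun i _ => Submodule.smul_mem _ _ (Submodule.subset_span ⟨i, rfl⟩)
  refine ⟨⟨_, he.generators_le hmem⟩, hmem, ?_⟩
  choose y hy hye using he.exists_mem
  have h6 : x - ⟨_, he.generators_le hmem⟩ = ∑ j, Q x (e (Sum.inr (Sum.inr j))) • y j := by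
    apply Subtype.ext
    have h7 := he.sum_smul x.2
    rw [Fintype.sum_sum_type] at h7
    have h8 : ((∑ j, Q x (e (Sum.inr (Sum.inr j))) • y j : derived s) : s) =
        ∑ j, Q x (e (Sum.inr (Sum.inr j))) • e (Sum.inr (Sum.inr j)) := by
      rw [show ((∑ j, Q x (e (Sum.inr (Sum.inr j))) • y j : derived s) : s) =
        (derived s).toSubmodule.subtype (∑ j, Q x (e (Sum.inr (Sum.inr j))) • y j) from rfl, map_sum]
      exact Finset.sum_congr rfl fun j _ => by rw [map_smul, ← hye j]; rfl
    rw [h8]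
    exact sub_eq_of_eq_add' h7.symm
  rw [h6]
  exact Submodule.sum_mem (LieSubmodule.toSubmodule _) fun j _ => Submodule.smul_mem _ _ (hy j)

end Flag
end MetricLie

/-! ### Normal operators perturbed by commuting skew operators. -/

namespace MetricLie

section Normal

variable {V : Type*} [AddCommGroup V] [Module ℝ V] {R : LinearMap.BilinForm ℝ V}
  {D D' E : Module.End ℝ V}

theorem IsInnerProduct.commute_adjoint_of_isSkew (hR : IsInnerProduct R)
    (hD : ∀ x y, R (D x) y = R x (D' y)) (hE : IsSkew R E) (hc : Commute D E) : Commute D' E := by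
  refine LinearMap.ext fun x => hR.ext fun y => ?_
  have h1 : D (E y) = E (D y) := LinearMap.congr_fun hc.eq y
  rw [Module.End.mul_apply, Module.End.mul_apply]
  calc R (D' (E x)) y = -R x (E (D y)) := by rw [hR.symm, ← hD, hR.symm, hE]
    _ = R (E (D' x)) y := by rw [← h1, hE, hR.symm (D' x), ← hD, hR.symm x]

theorem apply_smul_add_of_isSkew
    (hD : ∀ x y, R (D x) y = R x (D' y)) (hE : IsSkew R E) (c : ℝ) (x y : V) :
    R ((c • D + E) x) y = R x ((c • D' - E) y) := by
  simp only [LinearMap.add_apply, LinearMap.sub_apply, LinearMap.smul_apply, map_add, map_sub,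
    map_smul, smul_eq_mul, hD, hE x y]
  ring

/-- E commutes with D, hence with D*, and E* = -E; so adding E leaves the self-commutator unchanged.
-/
theorem IsInnerProduct.commutator_smul_add_of_isSkew (hR : IsInnerProduct R)
    (hD : ∀ x y, R (D x) y = R x (D' y)) (hE : IsSkew R E) (hc : Commute D E) (c : ℝ) :
    (c • D + E) * (c • D' - E) - (c • D' - E) * (c • D + E) = c ^ 2 • (D * D' - D' * D) := by
  have h1 := (hR.commute_adjoint_of_isSkew hD hE hc).eq
  have h2 := hc.eq
  simp only [add_mul, mul_sub, sub_mul, mul_add, smul_mul_assoc, mul_smul_comm, h1, h2, smul_sub,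
    smul_add, smul_smul, pow_two]
  abel

theorem IsInnerProduct.apply_commutator (hR : IsInnerProduct R)
    (hD : ∀ x y, R (D x) y = R x (D' y)) (x : V) :
    R ((D * D' - D' * D) x) x = R (D' x) (D' x) - R (D x) (D x) := by
  rw [LinearMap.sub_apply, map_sub, LinearMap.sub_apply, Module.End.mul_apply,
    Module.End.mul_apply, hD (D' x), hR.symm (D' (D x)), ← hD x (D x)]

theorem IsInnerProduct.commute_of_forall (hR : IsInnerProduct R)
    (hD : ∀ x y, R (D x) y = R x (D' y)) (h : ∀ x, R ((D * D' - D' * D) x) x = 0) :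
    Commute D D' := by
  have hsymm : ∀ x y, R ((D * D' - D' * D) x) y = R ((D * D' - D' * D) y) x := by
    intro x y
    have h2 : ∀ x y, R (D' (D x)) y = R (D x) (D y) := fun x y => by
      rw [hR.symm, ← hD, hR.symm]
    simp only [LinearMap.sub_apply, map_sub, Module.End.mul_apply, h2, hD (D' _)]
    rw [hR.symm (D' x), hR.symm (D x)]
  refine sub_eq_zero.1 (LinearMap.ext fun x => hR.ext fun y => ?_)
  have h1 := h (x + y)
  simp only [map_add, LinearMap.add_apply (R _), h, hsymm y x] at h1
  rw [LinearMap.zero_apply, map_zero, LinearMap.zero_apply]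
  linarith

end Normal

/-! ### The trichotomy and the Ricci spectrum in each case. -/

section Cases

variable {s : Type*} [LieRing s] [LieAlgebra ℝ s] {Q : LinearMap.BilinForm ℝ s}

theorem commute_adDerived {A B : s} (h : ⁅A, B⁆ = 0) :
    Commute (adDerived s A) (adDerived s B) := by
  refine LinearMap.ext fun x => Subtype.ext ?_
  change ⁅A, ⁅B, (x : s)⁆⁆ = ⁅B, ⁅A, (x : s)⁆⁆
  rw [leibniz_lie, h, zero_lie, zero_add]

section Basis

variable {κ ι : Type*} [Fintype κ] [Fintype ι] [DecidableEq κ] [DecidableEq ι]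
  {e : Module.Basis (κ ⊕ ι) ℝ s}

theorem IsAdapted.isSkew_iff (hQ : IsInnerProduct Q) (he : IsAdapted Q e) (A : s) :
    IsSkew (restrictDerived Q) (adDerived s A) ↔
      ∀ i j, symPart Q (fun i => e (Sum.inr i)) i j A = 0 := by
  refine ⟨fun h i j => ?_, fun h x y => he.lie_skew_of_symPart_eq_zero hQ h x.2 y.2⟩
  have h1 : Q ⁅A, e (Sum.inr i)⁆ (e (Sum.inr j)) = -Q (e (Sum.inr i)) ⁅A, e (Sum.inr j)⁆ :=
    h ⟨_, he.inr_mem i⟩ ⟨_, he.inr_mem j⟩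
  rw [symPart_apply, h1, hQ.symm]
  simp

/-- This identifies the positive part of `ricciDefect` with |D*Y|², so that for commutative n and
vanishing traces the defect is (1/2) ∑ ⟨[D_k, D_k*]Y, Y⟩. -/
theorem IsAdapted.sum_sq_adjoint (hQ : IsInnerProduct Q) (he : IsAdapted Q e) {A : s}
    {D' : Module.End ℝ (derived s)}
    (hD : ∀ x y, restrictDerived Q (adDerived s A x) y = restrictDerived Q x (D' y))
    (Y : derived s) :
    ∑ i, (Q ⁅A, e (Sum.inr i)⁆ Y) ^ 2 = restrictDerived Q (D' Y) (D' Y) := by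
  rw [show restrictDerived Q (D' Y) (D' Y) = Q (D' Y) (D' Y) from rfl,
    ← he.sum_sq hQ (D' Y).2]
  refine Finset.sum_congr rfl fun i _ => ?_
  rw [show Q ⁅A, e (Sum.inr i)⁆ Y = Q (e (Sum.inr i)) (D' Y) from hD ⟨_, he.inr_mem i⟩ Y, hQ.symm]

theorem IsAdapted.trace_adDerived [FiniteDimensional ℝ s] (he : IsAdapted Q e) (A : s) :
    LinearMap.trace ℝ (derived s) (adDerived s A) = traceOn Q (fun i => e (Sum.inr i)) A := by
  have h1 : LinearMap.trace ℝ (derived s) (adDerived s A) =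
      LinearMap.trace ℝ s (LieAlgebra.ad ℝ s A) :=
    LinearMap.trace_restrict_eq_of_forall_mem (derived s).toSubmodule (LieAlgebra.ad ℝ s A)
      fun x => lie_mem_derived A x
  rw [h1, trace_ad he.orthonormal, Fintype.sum_sum_type]
  simp only [he.lie_inl, Finset.sum_const_zero, zero_add, traceOn]

theorem lie_eq_zero_of_isLieAbelian (hab : IsLieAbelian (derived s)) {x y : s}
    (hx : x ∈ derived s) (hy : y ∈ derived s) : ⁅x, y⁆ = 0 :=
  congrArg Subtype.val (hab.trivial ⟨x, hx⟩ ⟨y, hy⟩)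

theorem IsAdapted.ricciDefect_of_isLieAbelian (he : IsAdapted Q e)
    (hab : IsLieAbelian (derived s))
    (htr : ∀ k, traceOn Q (fun i => e (Sum.inr i)) (e (Sum.inl k)) = 0) (Y : s) :
    ricciDefect Q e Y = (1 / 2) * ∑ k, (∑ i, (Q ⁅e (Sum.inl k), e (Sum.inr i)⁆ Y) ^ 2 -
        Q ⁅e (Sum.inl k), Y⁆ ⁅e (Sum.inl k), Y⁆) := by
  simp [ricciDefect, htr, lie_eq_zero_of_isLieAbelian hab (he.inr_mem _) (he.inr_mem _)]

end Basis

/-- Here [n, n] = 0, so vanishing of the defect on generators becomes vanishing on all of n. -/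
theorem IsFlagAdapted.mem_generators {κ π ρ : Type*} [Fintype κ] [Fintype π] [Fintype ρ]
    [DecidableEq κ] [DecidableEq π] [DecidableEq ρ] {e : Module.Basis (κ ⊕ (π ⊕ ρ)) ℝ s}
    (he : IsFlagAdapted Q e) (hab : IsLieAbelian (derived s)) {Y : s} (hY : Y ∈ derived s) :
    Y ∈ generators e := by
  have h0 : ∀ j, e (Sum.inr (Sum.inr j)) = 0 := by
    intro j
    obtain ⟨y, hy, hyj⟩ := he.exists_mem j
    rw [LieSubmodule.lie_eq_bot_iff _ _ |>.2 fun x _ m _ => hab.trivial x m,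
      LieSubmodule.mem_bot] at hy
    rw [← hyj, hy, ZeroMemClass.coe_zero]
  rw [← he.sum_smul hY, Fintype.sum_sum_type]
  simp only [h0, smul_zero, Finset.sum_const_zero, add_zero]
  exact Submodule.sum_mem _ fun i _ => Submodule.smul_mem _ _ (Submodule.subset_span ⟨i, rfl⟩)

theorem skewPart_le_complement : skewPart Q ≤ complement Q := fun _ h => h.1

variable [FiniteDimensional ℝ s]

theorem not_caseThree_of_ricciOperator_eq_zero (hQ : IsInnerProduct Q)
    (h : ricciOperator hQ = 0) : ¬CaseThree hQ := by
  rw [CaseThree, ricciEigenvalues, h, LinearMap.charpoly_zero, Polynomial.roots_X_pow,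
    Multiset.filter_eq_nil.2]
  · simp
  · intro a ha
    rw [Multiset.mem_nsmul] at ha
    rw [Multiset.mem_singleton.1 ha.2]
    exact lt_irrefl 0

variable [LieAlgebra.IsSolvable s]

theorem caseOne_or_caseTwo (hQ : IsInnerProduct Q) (h3 : ¬CaseThree hQ) :
    CaseOne Q ∨ CaseTwo Q := by
  obtain ⟨m, p, r, e, he⟩ := exists_isFlagAdapted hQ
  have hc : ∀ A ∈ complement Q, ∀ B ∈ complement Q, ⁅A, B⁆ = 0 :=
    fun A hA B hB => he.complement_commutative hQ h3 hA hB
  by_cases hS : ∃ X ∈ complement Q, symNorm Q (fun i => e (Sum.inr i)) X ≠ 0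
  · obtain ⟨X, hX, hX0⟩ := hS
    have htr := he.traceOn_eq_zero_of_not_caseThree hQ h3 hX hX0
    have h0 : ∀ Y ∈ generators e, ricciDefect Q e Y = 0 := fun Y hY =>
      he.ricciDefect_eq_zero hQ htr (fun Y _ => he.ricciDefect_nonneg hQ h3 hX hX0 Y) hY
    have hab := he.isLieAbelian_derived hQ h3 h0
    have hR : IsInnerProduct (restrictDerived Q) := hQ.restrict _
    have hmod : ∀ A ∈ complement Q, ∃ β : ℝ,
        IsSkew (restrictDerived Q) (adDerived s (A - β • X)) ∧ A - β • X ∈ complement Q := by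
      intro A hA
      obtain ⟨β, hβ⟩ := he.exists_symPart_eq_mul hQ h3 hX hX0 hA
      exact ⟨β, (he.isSkew_iff hQ _).2 hβ,
        Submodule.sub_mem _ hA (Submodule.smul_mem _ _ hX)⟩
    have hXb : X ∉ skewPart Q := fun h => hX0 (by
      have := (he.isSkew_iff hQ X).1 h.2
      simp [symNorm, this])
    obtain ⟨D', hD'⟩ := hR.exists_adjoint (adDerived s X)
    have hdecomp : ∀ (A : s) (β : ℝ), adDerived s A =
        β • adDerived s X + adDerived s (A - β • X) := by
      intro A β
      rw [← map_smul, ← map_add, add_sub_cancel]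
    have hadj : ∀ A ∈ complement Q, ∀ β : ℝ,
        IsSkew (restrictDerived Q) (adDerived s (A - β • X)) → ∃ A' : Module.End ℝ (derived s),
        (∀ x y, restrictDerived Q (adDerived s A x) y = restrictDerived Q x (A' y)) ∧
        adDerived s A * A' - A' * adDerived s A =
          β ^ 2 • (adDerived s X * D' - D' * adDerived s X) := by
      intro A hA β hβ
      have hcomm : Commute (adDerived s X) (adDerived s (A - β • X)) :=
        commute_adDerived (hc X hX _ (Submodule.sub_mem _ hA (Submodule.smul_mem _ _ hX)))
      refine ⟨β • D' - adDerived s (A - β • X), fun x y => ?_, ?_⟩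
      · conv_lhs => rw [hdecomp A β]
        exact apply_smul_add_of_isSkew hD' hβ β x y
      · have := hR.commutator_smul_add_of_isSkew hD' hβ hcomm β
        rwa [← hdecomp A β] at this
    choose β hβ _ using fun k => hmod _ (he.inl_mem k)
    -- If every β_k were zero, all a_k, hence X, would act by skew operators.
    have hpos : 0 < ∑ k, β k ^ 2 := by
      refine (Finset.sum_nonneg fun k _ => sq_nonneg _).lt_of_ne fun h => hXb ⟨hX, ?_⟩
      have h1 := fun k => (Finset.sum_eq_zero_iff_of_nonneg fun k _ => sq_nonneg (β k)).1 h.symm k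
        (Finset.mem_univ k)
      have h2 : ∀ k, e (Sum.inl k) ∈ skewPart Q := by
        intro k
        have h4 := hβ k
        rw [pow_eq_zero_iff two_ne_zero |>.1 (h1 k), zero_smul, sub_zero] at h4
        exact ⟨he.inl_mem k, h4⟩
      have h3 : X ∈ skewPart Q := by
        rw [← he.sum_smul_inl hQ hX]
        exact Submodule.sum_mem _ fun k _ => Submodule.smul_mem _ _ (h2 k)
      exact h3.2
    have hnormal : Commute (adDerived s X) D' := by
      refine hR.commute_of_forall hD' fun Y => ?_
      have h1 := h0 Y (he.mem_generators hab Y.2)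
      rw [he.ricciDefect_of_isLieAbelian hab htr] at h1
      -- Since ad(a_k) is β_k ad(X) plus a commuting skew operator, all self-commutators are
      -- multiples of that of ad(X).
      have h2 : ∀ k, ∑ i, (Q ⁅e (Sum.inl k), e (Sum.inr i)⁆ Y) ^ 2 -
          Q ⁅e (Sum.inl k), (Y : s)⁆ ⁅e (Sum.inl k), (Y : s)⁆ = β k ^ 2 *
          restrictDerived Q ((adDerived s X * D' - D' * adDerived s X) Y) Y := by
        intro k
        obtain ⟨A', hA', hA⟩ := hadj _ (he.inl_mem k) (β k) (hβ k)
        have h4 := hR.apply_commutator hA' Y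
        rw [hA, LinearMap.smul_apply, map_smul, LinearMap.smul_apply, smul_eq_mul] at h4
        rw [h4, he.sum_sq_adjoint hQ hA']
        rfl
      simp only [h2] at h1
      rw [← Finset.sum_mul] at h1
      have h5 : (∑ k, β k ^ 2) *
          restrictDerived Q ((adDerived s X * D' - D' * adDerived s X) Y) Y = 0 := by linarith
      exact (mul_eq_zero.1 h5).resolve_left hpos.ne'
    refine Or.inr ⟨hab, hc, fun A hA => ⟨?_, ?_⟩, ?_⟩
    · rw [← he.sum_smul_inl hQ hA, map_sum, map_sum]
      exact Finset.sum_eq_zero fun k _ => by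
        rw [map_smul, map_smul, he.trace_adDerived, htr, smul_zero]
    · obtain ⟨b, hb, -⟩ := hmod A hA
      obtain ⟨A', hA', hA⟩ := hadj A hA b hb
      refine ⟨A', hA', sub_eq_zero.1 ?_⟩
      rw [hA, sub_eq_zero.2 hnormal.eq, smul_zero]
    · rw [← Submodule.finrank_sup_span_singleton hXb]
      suffices h : skewPart Q ⊔ Submodule.span ℝ {X} = complement Q by rw [h]
      refine le_antisymm (sup_le skewPart_le_complement ?_) fun A hA => ?_
      · rwa [Submodule.span_singleton_le_iff_mem]
      · obtain ⟨b, hb, hb'⟩ := hmod A hA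
        exact Submodule.mem_sup.2 ⟨A - b • X, ⟨hb', hb⟩, b • X,
          Submodule.smul_mem _ _ (Submodule.mem_span_singleton_self X), sub_add_cancel _ _⟩
  · push Not at hS
    have hS' : ∀ A ∈ complement Q, ∀ i j, symPart Q (fun i => e (Sum.inr i)) i j A = 0 :=
      fun A hA => symNorm_eq_zero (hS A hA)
    have h0 : ∀ Y ∈ generators e, ricciDefect Q e Y = 0 := by
      intro Y hY
      rw [he.ricciDefect_of_skew hQ (fun k => hS' _ (he.inl_mem k)) (he.generators_le hY)]
      simp [apply_generators_eq_zero
        (fun l => he.perp _ (he.inr_mem _) _ (he.inr_mem _) l) hY]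
    exact Or.inl ⟨he.isLieAbelian_derived hQ h3 h0, hc, fun A hA =>
      (he.isSkew_iff hQ A).2 (hS' A hA)⟩

theorem CaseOne.ricciOperator_eq_zero (hQ : IsInnerProduct Q) (h : CaseOne Q) :
    ricciOperator hQ = 0 := by
  obtain ⟨m, p, r, e, he⟩ := exists_isFlagAdapted hQ
  obtain ⟨hab, hc, hS⟩ := h
  have hS' : ∀ A ∈ complement Q, ∀ i j, symPart Q (fun i => e (Sum.inr i)) i j A = 0 :=
    fun A hA => (he.isSkew_iff hQ A).1 (hS A hA)
  have h0 : ricciForm hQ = 0 := by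
    refine ricciForm_eq_of_forall_self hQ 0 (fun _ _ => rfl) fun Z => ?_
    obtain ⟨A, hA, Y, hY, rfl⟩ := he.exists_add Z
    rw [he.ricciForm_add hQ hc hA, he.ricciDefect_of_skew hQ (fun k => hS' _ (he.inl_mem k)) hY]
    have h1 : ∀ i j, symPart Q (fun i => e (Sum.inr i)) i j Y = 0 := fun i j => by
      simp [symPart_apply, lie_eq_zero_of_isLieAbelian hab hY (he.inr_mem _)]
    simp [symNorm, hS' A hA, h1, lie_eq_zero_of_isLieAbelian hab (he.inr_mem _) (he.inr_mem _)]
  rw [ricciOperator, h0, LinearMap.comp_zero]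

theorem CaseTwo.exists_ricciEigenvalues_eq (hQ : IsInnerProduct Q) (h : CaseTwo Q) :
    ∃ c : ℝ, c < 0 ∧ ricciEigenvalues hQ =
      c ::ₘ Multiset.replicate (Module.finrank ℝ s - 1) 0 := by
  obtain ⟨m, p, r, e, he⟩ := exists_isFlagAdapted hQ
  obtain ⟨hab, hc, hN, hdim⟩ := h
  have hR : IsInnerProduct (restrictDerived Q) := hQ.restrict _
  obtain ⟨X, hX, hXb⟩ : ∃ X ∈ complement Q, X ∉ skewPart Q := by
    by_contra hcon
    push Not at hcon
    rw [le_antisymm skewPart_le_complement hcon] at hdim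
    omega
  have hsup : skewPart Q ⊔ Submodule.span ℝ {X} = complement Q := by
    refine Submodule.eq_of_le_of_finrank_eq (sup_le skewPart_le_complement ?_) ?_
    · rwa [Submodule.span_singleton_le_iff_mem]
    · rw [Submodule.finrank_sup_span_singleton hXb, hdim]
  have htr : ∀ k, traceOn Q (fun i => e (Sum.inr i)) (e (Sum.inl k)) = 0 := fun k => by
    rw [← he.trace_adDerived, (hN _ (he.inl_mem k)).1]
  have hdef : ∀ Y ∈ derived s, ricciDefect Q e Y = 0 := by
    intro Y hY
    rw [he.ricciDefect_of_isLieAbelian hab htr]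
    refine mul_eq_zero_of_right _ (Finset.sum_eq_zero fun k _ => ?_)
    obtain ⟨A', hA', hcomm⟩ := (hN _ (he.inl_mem k)).2
    have h1 := hR.apply_commutator hA' ⟨Y, hY⟩
    rw [sub_eq_zero.2 hcomm.eq, LinearMap.zero_apply, map_zero, LinearMap.zero_apply,
      ← he.sum_sq_adjoint hQ hA'] at h1
    exact h1.symm
  set S := symPart Q (fun i => e (Sum.inr i)) with hSdef
  set N := symNorm Q (fun i => e (Sum.inr i)) X with hNdef
  have hNpos : 0 < N := by
    refine (symNorm_nonneg _ _).lt_of_ne fun h => hXb ⟨hX, ?_⟩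
    exact (he.isSkew_iff hQ X).2 (symNorm_eq_zero h.symm)
  have hSZ : ∀ Z, ∃ b : ℝ, ∀ i j, S i j Z = b * S i j X := by
    intro Z
    obtain ⟨A, hA, Y, hY, rfl⟩ := he.exists_add Z
    rw [← hsup] at hA
    obtain ⟨B, hB, W, hW, rfl⟩ := Submodule.mem_sup.1 hA
    obtain ⟨b, rfl⟩ := Submodule.mem_span_singleton.1 hW
    refine ⟨b, fun i j => ?_⟩
    have h1 : S i j Y = 0 := by
      simp [hSdef, symPart_apply, lie_eq_zero_of_isLieAbelian hab hY (he.inr_mem _)]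
    have h2 : S i j B = 0 := (he.isSkew_iff hQ B).1 hB.2 i j
    rw [map_add, map_add, map_smul, h1, h2, smul_eq_mul]
    ring
  -- The form Z ↦ ⟨S(X), S(Z)⟩; as S(Z) is always a multiple of S(X), |S(Z)|² = f(Z)² / N.
  let f : Module.Dual ℝ s := ∑ i, ∑ j, S i j X • S i j
  have hf : ∀ (Z : s) (b : ℝ), (∀ i j, S i j Z = b * S i j X) → f Z = b * N := by
    intro Z b hb
    simp only [f, LinearMap.sum_apply, LinearMap.smul_apply, hb, smul_eq_mul, hNdef, symNorm,
      Finset.mul_sum]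
    exact Finset.sum_congr rfl fun i _ => Finset.sum_congr rfl fun j _ => by ring
  have hform : ricciForm hQ = (-N⁻¹) • LinearMap.BilinForm.linMulLin f f := by
    refine ricciForm_eq_of_forall_self hQ _ (fun A B => ?_) fun Z => ?_
    · simp [mul_comm]
    obtain ⟨b, hb⟩ := hSZ Z
    have h1 : symNorm Q (fun i => e (Sum.inr i)) Z = b ^ 2 * N := by
      simp only [symNorm, ← hSdef, hb, mul_pow, hNdef, Finset.mul_sum]
    have h2 : ricciForm hQ Z Z = -symNorm Q (fun i => e (Sum.inr i)) Z := by
      obtain ⟨A, hA, Y, hY, rfl⟩ := he.exists_add Z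
      rw [he.ricciForm_add hQ hc hA, hdef Y hY, add_zero]
    rw [h2, h1, LinearMap.smul_apply, LinearMap.smul_apply, LinearMap.BilinForm.linMulLin_apply,
      hf Z b hb, smul_eq_mul]
    field_simp
  refine hQ.roots_eq_cons_replicate (f := f) (c := -N⁻¹) (by simpa using hNpos) (fun h0 => ?_)
    fun A B => ?_
  · have h1 := hf X 1 fun i j => (one_mul _).symm
    rw [h0, LinearMap.zero_apply, one_mul] at h1
    exact hNpos.ne h1
  · rw [ricciOperator_apply, hform]
    rfl

end Cases

end MetricLie

theorem theorem1 {s : Type*} [LieRing s] [LieAlgebra ℝ s] [FiniteDimensional ℝ s]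
    [LieAlgebra.IsSolvable s] (Q : LinearMap.BilinForm ℝ s) (hQ : MetricLie.IsInnerProduct Q) :
    (MetricLie.CaseOne Q ∨ MetricLie.CaseTwo Q ∨ MetricLie.CaseThree hQ) ∧
    ¬(MetricLie.CaseOne Q ∧ MetricLie.CaseTwo Q) ∧
    ¬(MetricLie.CaseOne Q ∧ MetricLie.CaseThree hQ) ∧
    ¬(MetricLie.CaseTwo Q ∧ MetricLie.CaseThree hQ) ∧
    (MetricLie.CaseOne Q → MetricLie.ricciOperator hQ = 0) ∧
    (MetricLie.CaseTwo Q → ∃ c : ℝ, c < 0 ∧ MetricLie.ricciEigenvalues hQ =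
      c ::ₘ Multiset.replicate (Module.finrank ℝ s - 1) 0) := by
  refine ⟨?_, ?_, ?_, ?_, fun h => h.ricciOperator_eq_zero hQ,
    fun h => h.exists_ricciEigenvalues_eq hQ⟩
  · by_cases h3 : MetricLie.CaseThree hQ
    · exact Or.inr (Or.inr h3)
    · exact (MetricLie.caseOne_or_caseTwo hQ h3).imp_right Or.inl
  · rintro ⟨h1, h2⟩
    have h3 : MetricLie.skewPart Q = MetricLie.complement Q :=
      le_antisymm MetricLie.skewPart_le_complement fun A hA => ⟨hA, h1.2.2 A hA⟩
    have h4 := h2.2.2.2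
    rw [h3] at h4
    omega
  · rintro ⟨h1, h3⟩
    exact MetricLie.not_caseThree_of_ricciOperator_eq_zero hQ (h1.ricciOperator_eq_zero hQ) h3
  · rintro ⟨h2, h3⟩
    obtain ⟨c, hc, he⟩ := h2.exists_ricciEigenvalues_eq hQ
    have h0 : (Multiset.replicate (Module.finrank ℝ s - 1) (0 : ℝ)).filter (· < 0) = 0 :=
      Multiset.filter_eq_nil.2 fun a ha => by
        rw [Multiset.eq_of_mem_replicate ha]
        exact lt_irrefl 0
    rw [MetricLie.CaseThree, he, Multiset.filter_cons_of_pos (p := (· < 0)) _ hc, h0] at h3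
    simp at h3
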